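/- Let $\lambda>0$ and let $f\in C(\mathbb R,\mathbb R)$ be odd and such that $\lim_{t\to0}f(t)/t=0$; $\lim_{t\to\infty}f(t)/t^3=1$ and $f(t)/t^3<1$ for all $t\neq0$; $t\mapsto f(t)/t^3$ is strictly increasing on $(0,\infty)$; and $\lim_{t\to\infty}[f(t)t-4F(t)]=+\infty$, where $F(t)=\int_0^t f(\tau)\,d\tau$. Let $H^1_{rad}(\mathbb R^3)$ be the space of radial functions in the real Sobolev space $H^1(\mathbb R^3)$, with the norm $\|u\|=\left(|\nabla u|_2^2+|u|_2^2\right)^{1/2}$, let $$\phi_u(x)=\int_{\mathbb R^3}\frac{u(y)^2}{4\pi|x-y|}\,dy,$$ and let $I:H^1_{rad}(\mathbb R^3)\to\mathbb R$ be the functional $$I(u)=\frac12\int_{\mathbb R^3}\left(|\nabla u|^2+u^2\right)dx+\frac\lambda4\int_{\mathbb R^3}\phi_u u^2\,dx-\int_{\mathbb R^3}F(u)\,dx,$$ with Fréchet derivative $I'$. Put $u^+=\max\{u,0\}$, $u^-=\min\{u,0\}$, $$\mathcal N=\left\{u\in H^1_{rad}(\mathbb R^3)\setminus\{0\}: I'(u)[u]=0\right\},\qquad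 \mathcal M=\left\{u\in\mathcal N: I'(u)[u^+]=0,\ u^+\not\equiv0,\ u^-\not\equiv0\right\}.$$ **Proposition 3.2.** The nodal Nehari set $\mathcal M$ is closed in $H^1_{rad}(\mathbb R^3)$. -/

import Mathlib

open MeasureTheory Filter Topology
open scoped ContDiff

/-- Euclidean three-space. -/
abbrev R3 : Type := EuclideanSpace ℝ (Fin 3)

/-- The square integrable vector field `g` is the weak gradient of `u`:
`∫ u ∂ᵢφ = - ∫ gᵢ φ` for every smooth compactly supported `φ` and every `i`. -/
def IsWeakGradient (u : Lp ℝ 2 (volume : Measure R3)) (g : Lp R3 2 (volume : Measure R3)) : Prop :=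
  ∀ φ : R3 → ℝ, ContDiff ℝ ∞ φ → HasCompactSupport φ → ∀ i : Fin 3,
    ∫ x, u x * fderiv ℝ φ x (EuclideanSpace.single i 1) = - ∫ x, g x i * φ x

/-- A function (class) on three-space is radial if it agrees almost everywhere with a function
of `|x|`. -/
def IsRadial (u : Lp ℝ 2 (volume : Measure R3)) : Prop :=
  ∃ ρ : ℝ → ℝ, ∀ᵐ x ∂(volume : Measure R3), u x = ρ ‖x‖

theorem memLp_test {φ : R3 → ℝ} (h1 : ContDiff ℝ ∞ φ) (h2 : HasCompactSupport φ) :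
    MemLp φ 2 (volume : Measure R3) :=
  h1.continuous.memLp_of_hasCompactSupport h2

theorem memLp_fderiv_test {φ : R3 → ℝ} (h1 : ContDiff ℝ ∞ φ) (h2 : HasCompactSupport φ)
    (v : R3) : MemLp (fun x => fderiv ℝ φ x v) 2 (volume : Measure R3) := by
  have hc : Continuous (fun x => fderiv ℝ φ x v) :=
    (h1.continuous_fderiv (by simp)).clm_apply continuous_const
  exact hc.memLp_of_hasCompactSupport (h2.fderiv_apply ℝ v)

theorem memLp_coord (g : Lp R3 2 (volume : Measure R3)) (i : Fin 3) :
    MemLp (fun x => g x i) 2 (volume : Measure R3) :=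
  (EuclideanSpace.proj i : R3 →L[ℝ] ℝ).comp_memLp' (Lp.memLp g)

theorem IsWeakGradient.add {u v : Lp ℝ 2 (volume : Measure R3)}
    {g h : Lp R3 2 (volume : Measure R3)}
    (hu : IsWeakGradient u g) (hv : IsWeakGradient v h) : IsWeakGradient (u + v) (g + h) := by
  intro φ h1 h2 i
  have e1 : ∫ x, (u + v : Lp ℝ 2 (volume : Measure R3)) x
        * fderiv ℝ φ x (EuclideanSpace.single i 1)
      = ∫ x, (u x * fderiv ℝ φ x (EuclideanSpace.single i 1)
        + v x * fderiv ℝ φ x (EuclideanSpace.single i 1)) := by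
    apply integral_congr_ae
    filter_upwards [Lp.coeFn_add u v] with x hx
    rw [hx, Pi.add_apply, add_mul]
  have e2 : ∫ x, (g + h : Lp R3 2 (volume : Measure R3)) x i * φ x
      = ∫ x, (g x i * φ x + h x i * φ x) := by
    apply integral_congr_ae
    filter_upwards [Lp.coeFn_add g h] with x hx
    rw [hx, Pi.add_apply, PiLp.add_apply, add_mul]
  rw [e1, e2, integral_add, integral_add, hu φ h1 h2 i, hv φ h1 h2 i]
  · ring
  · exact (memLp_coord g i).integrable_mul (memLp_test h1 h2)
  · exact (memLp_coord h i).integrable_mul (memLp_test h1 h2)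
  · exact (Lp.memLp u).integrable_mul (memLp_fderiv_test h1 h2 _)
  · exact (Lp.memLp v).integrable_mul (memLp_fderiv_test h1 h2 _)

theorem IsWeakGradient.smul {u : Lp ℝ 2 (volume : Measure R3)}
    {g : Lp R3 2 (volume : Measure R3)} (c : ℝ)
    (hu : IsWeakGradient u g) : IsWeakGradient (c • u) (c • g) := by
  intro φ h1 h2 i
  have e1 : ∫ x, (c • u : Lp ℝ 2 (volume : Measure R3)) x
        * fderiv ℝ φ x (EuclideanSpace.single i 1)
      = ∫ x, c * (u x * fderiv ℝ φ x (EuclideanSpace.single i 1)) := by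
    apply integral_congr_ae
    filter_upwards [Lp.coeFn_smul c u] with x hx
    rw [hx, Pi.smul_apply, smul_eq_mul, mul_assoc]
  have e2 : ∫ x, (c • g : Lp R3 2 (volume : Measure R3)) x i * φ x
      = ∫ x, c * (g x i * φ x) := by
    apply integral_congr_ae
    filter_upwards [Lp.coeFn_smul c g] with x hx
    rw [hx, Pi.smul_apply, PiLp.smul_apply, smul_eq_mul, mul_assoc]
  rw [e1, e2, integral_const_mul, integral_const_mul, hu φ h1 h2 i]
  ring

theorem IsWeakGradient.zero : IsWeakGradient 0 0 := by
  intro φ h1 h2 i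
  have e1 : ∫ x, (0 : Lp ℝ 2 (volume : Measure R3)) x
        * fderiv ℝ φ x (EuclideanSpace.single i 1) = ∫ _x : R3, (0 : ℝ) := by
    apply integral_congr_ae
    filter_upwards [Lp.coeFn_zero ℝ 2 (volume : Measure R3)] with x hx
    simp
  have e2 : ∫ x, (0 : Lp R3 2 (volume : Measure R3)) x i * φ x = ∫ _x : R3, (0 : ℝ) := by
    apply integral_congr_ae
    filter_upwards [Lp.coeFn_zero R3 2 (volume : Measure R3)] with x hx
    simp
  rw [e1, e2]
  simp

theorem IsRadial.zero : IsRadial 0 := by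
  refine ⟨fun _ => 0, ?_⟩
  filter_upwards [Lp.coeFn_zero ℝ 2 (volume : Measure R3)] with x hx
  simp

theorem IsRadial.add {u v : Lp ℝ 2 (volume : Measure R3)} (hu : IsRadial u) (hv : IsRadial v) :
    IsRadial (u + v) := by
  obtain ⟨ρ, hρ⟩ := hu
  obtain ⟨σ, hσ⟩ := hv
  refine ⟨fun r => ρ r + σ r, ?_⟩
  filter_upwards [Lp.coeFn_add u v, hρ, hσ] with x hx h1 h2
  rw [hx, Pi.add_apply, h1, h2]

theorem IsRadial.smul {u : Lp ℝ 2 (volume : Measure R3)} (c : ℝ) (hu : IsRadial u) :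
    IsRadial (c • u) := by
  obtain ⟨ρ, hρ⟩ := hu
  refine ⟨fun r => c * ρ r, ?_⟩
  filter_upwards [Lp.coeFn_smul c u, hρ] with x hx h1
  rw [hx, Pi.smul_apply, h1, smul_eq_mul]

/-- The Sobolev space `H¹(ℝ³)`, realised as the set of pairs `(u, ∇u)` of a square integrable
function and its (unique, square integrable) weak gradient. The inherited Hilbert norm is
`‖u‖ = (|∇u|₂² + |u|₂²)^(1/2)`. -/
def H1 : Submodule ℝ
    (WithLp 2 (Lp ℝ 2 (volume : Measure R3) × Lp R3 2 (volume : Measure R3))) where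
  carrier := {p | IsWeakGradient p.fst p.snd}
  add_mem' hp hq := hp.add hq
  zero_mem' := IsWeakGradient.zero
  smul_mem' c _ hp := hp.smul c

/-- The subspace `H¹_rad(ℝ³)` of radial functions of `H¹(ℝ³)`, with the `H¹` norm. -/
def H1rad : Submodule ℝ
    (WithLp 2 (Lp ℝ 2 (volume : Measure R3) × Lp R3 2 (volume : Measure R3))) where
  carrier := {p | p ∈ H1 ∧ IsRadial p.fst}
  add_mem' hp hq := ⟨H1.add_mem hp.1 hq.1, hp.2.add hq.2⟩
  zero_mem' := ⟨H1.zero_mem, IsRadial.zero⟩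
  smul_mem' c _ hp := ⟨H1.smul_mem c hp.1, hp.2.smul c⟩

/-- The function (class) underlying an element of `H¹_rad(ℝ³)`. -/
def radFn (u : H1rad) : Lp ℝ 2 (volume : Measure R3) :=
  (u : WithLp 2 (Lp ℝ 2 (volume : Measure R3) × Lp R3 2 (volume : Measure R3))).fst

/-- The (weak) gradient of an element of `H¹_rad(ℝ³)`. -/
def radGrad (u : H1rad) : Lp R3 2 (volume : Measure R3) :=
  (u : WithLp 2 (Lp ℝ 2 (volume : Measure R3) × Lp R3 2 (volume : Measure R3))).snd

/-- The Newton potential `φ_u = (1 / (4π|·|)) * u²`. -/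
noncomputable def newtonPotential (u : R3 → ℝ) (x : R3) : ℝ :=
  ∫ y, 1 / (4 * Real.pi * ‖x - y‖) * u y ^ 2

/-- The primitive `F(t) = ∫₀ᵗ f`. -/
noncomputable def primitiveF (f : ℝ → ℝ) (t : ℝ) : ℝ := ∫ τ in (0 : ℝ)..t, f τ

/-- The standing assumptions on the (asymptotically cubic) nonlinearity. -/
structure AsymptoticallyCubic (f : ℝ → ℝ) : Prop where
  continuous : Continuous f
  odd : ∀ t, f t = - f (-t)
  zero_limit : Tendsto (fun t => f t / t) (𝓝[≠] 0) (𝓝 0)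
  infinity_limit : Tendsto (fun t => f t / t ^ 3) atTop (𝓝 1)
  lt_one : ∀ t, t ≠ 0 → f t / t ^ 3 < 1
  strictMono : StrictMonoOn (fun t => f t / t ^ 3) (Set.Ioi 0)
  nonquadraticity : Tendsto (fun t => f t * t - 4 * primitiveF f t) atTop atTop

/-- The energy functional
`I(u) = 1/2 ∫ (|∇u|² + u²) + λ/4 ∫ φ_u u² - ∫ F(u)` on `H¹_rad(ℝ³)`. -/
noncomputable def energy (f : ℝ → ℝ) (lam : ℝ) (u : H1rad) : ℝ :=
  1 / 2 * (∫ x, (‖radGrad u x‖ ^ 2 + radFn u x ^ 2))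
    + lam / 4 * (∫ x, newtonPotential (radFn u) x * radFn u x ^ 2)
    - (∫ x, primitiveF f (radFn u x))

/-- The Nehari set `𝓝 = {u ∈ H¹_rad ∖ {0} : I'(u)[u] = 0}`, where `I'` is the Fréchet derivative
of the energy functional on `H¹_rad(ℝ³)`. -/
def nehariSet (f : ℝ → ℝ) (lam : ℝ) : Set H1rad :=
  {u | u ≠ 0 ∧ fderiv ℝ (energy f lam) u u = 0}

/-- The nodal Nehari set `𝓜 = {u ∈ 𝓝 : I'(u)[u⁺] = 0, u⁺ ≢ 0, u⁻ ≢ 0}` with `u⁺ = max(u, 0)`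
and `u⁻ = min(u, 0)`. Here `v` is the function `u⁺` regarded as an element of `H¹_rad(ℝ³)`. -/
def nodalNehariSet (f : ℝ → ℝ) (lam : ℝ) : Set H1rad :=
  {u | u ∈ nehariSet f lam ∧
    (∃ v : H1rad, radFn v = radFn u ⊔ 0 ∧ fderiv ℝ (energy f lam) u v = 0) ∧
    radFn u ⊔ 0 ≠ 0 ∧ radFn u ⊓ 0 ≠ 0}

/-!
The energy is continuously differentiable on `H¹_rad(ℝ³)`, with
`I'(u)[v] = ⟪u, v⟫ + λ ∫ φ_u u v - ∫ f(u) v` (`exists_fderiv_energy`). This rests on the embedding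
into `L⁴` (`H1rad.exists_eLpNorm_four_le`). The Hartree term is a bounded four-linear form on the
diagonal (`exists_fderiv_hartree`). For the term `∫ F(u)` a pointwise modulus of continuity of `f`
relative to the weight `|t| + |t|³` (`AsymptoticallyCubic.exists_increment_bound`) is integrated
(`AsymptoticallyCubic.exists_fderiv_potential`).

Let `uₙ → u` with `uₙ` in the nodal Nehari set. The equation `I'(u)[u] = 0` follows from the
continuity of `I'`. If `w` is `uₙ⁺` or `uₙ⁻`, then `‖w‖² ≤ ⟪uₙ, w⟫`, and `I'(uₙ)[w] = 0` together
with `f(t) t ≤ t⁴` and the sign of the Hartree term gives `‖w‖² ≤ |w|₄⁴`. By the Sobolev inequality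
`|w|₄` is bounded below by a positive constant (`one_le_integral_pow_four`), so neither `u⁺` nor `u⁻`
vanishes. Finally `uₙ⁺` is bounded in `H¹` and converges to `u⁺` in `L²`, hence weakly in `H¹`, and
`I'(uₙ) → I'(u)` in norm, so `I'(u)[u⁺] = 0` (`map_posPart_eq_zero_of_tendsto`). Continuity of
`u ↦ u⁺` in `H¹` is not used.

That `u⁺` belongs to `H¹` with `|∇u⁺|₂² ≤ ∫ ∇u · ∇u⁺` is `IsWeakGradient.sup_zero`. Like the Sobolev
inequality it is transferred from test functions, which approximate `u` in `L²` with control of the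
gradient norm (`IsWeakGradient.exists_test_approx`), by mollification and cutoff.
-/

open scoped ENNReal Convolution
open ContinuousLinearMap (lsmul)

/-! ### Mollification -/

theorem eLpNorm_two_sq {α F : Type*} [MeasurableSpace α] [NormedAddCommGroup F] (μ : Measure α)
    (f : α → F) : eLpNorm f 2 μ ^ 2 = ∫⁻ x, ‖f x‖ₑ ^ 2 ∂μ := by
  have := eLpNorm_nnreal_pow_eq_lintegral (μ := μ) (f := f) (p := 2) (by norm_num)
  simpa using this

theorem lintegral_mul_sq_le {α : Type*} [MeasurableSpace α] (μ : Measure α) {f g : α → ℝ≥0∞}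
    (hf : AEMeasurable f μ) (hg : AEMeasurable g μ) :
    (∫⁻ x, f x * g x ∂μ) ^ 2 ≤ (∫⁻ x, f x ^ 2 ∂μ) * ∫⁻ x, g x ^ 2 ∂μ := by
  have h := ENNReal.lintegral_mul_le_Lp_mul_Lq μ (p := 2) (q := 2)
    Real.HolderConjugate.two_two hf hg
  simp only [Pi.mul_apply, ENNReal.rpow_two] at h
  calc _ ≤ _ := pow_le_pow_left' h 2
    _ = _ := by
      rw [mul_pow, ← ENNReal.rpow_natCast, ← ENNReal.rpow_natCast, ← ENNReal.rpow_mul,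
        ← ENNReal.rpow_mul]
      norm_num

/-- Convolution with a density of total mass one does not increase the `L²` norm: Cauchy–Schwarz
with respect to the weight `|ρ|`, then Tonelli. -/
theorem eLpNorm_convolution_le {F : Type*} [NormedAddCommGroup F] [NormedSpace ℝ F]
    {ρ : R3 → ℝ} (hρ : Measurable ρ) (hρ1 : ∫⁻ x, ‖ρ x‖ₑ = 1)
    {G : R3 → F} (hG : StronglyMeasurable G) :
    eLpNorm (ρ ⋆[lsmul ℝ ℝ, volume] G) 2 volume ≤ eLpNorm G 2 volume := by
  have hGm : Measurable fun x => ‖G x‖ₑ := hG.enorm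
  have hprod : Measurable fun p : R3 × R3 => ‖ρ p.2‖ₑ * ‖G (p.1 - p.2)‖ₑ ^ 2 :=
    (hρ.enorm.comp measurable_snd).mul
      ((hGm.comp (measurable_fst.sub measurable_snd)).pow_const 2)
  have key : ∀ x, ‖(ρ ⋆[lsmul ℝ ℝ, volume] G) x‖ₑ ^ 2
      ≤ ∫⁻ t, ‖ρ t‖ₑ * ‖G (x - t)‖ₑ ^ 2 := by
    intro x
    have h1 : ‖(ρ ⋆[lsmul ℝ ℝ, volume] G) x‖ₑ ≤ ∫⁻ t, ‖ρ t‖ₑ * ‖G (x - t)‖ₑ := by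
      refine (enorm_integral_le_lintegral_enorm _).trans (le_of_eq ?_)
      simp [enorm_smul]
    have hm : Measurable fun t => ‖G (x - t)‖ₑ := hGm.comp (measurable_const.sub measurable_id)
    have h2 := lintegral_mul_sq_le volume (f := fun t => ‖ρ t‖ₑ ^ (1/2 : ℝ))
      (g := fun t => ‖ρ t‖ₑ ^ (1/2 : ℝ) * ‖G (x - t)‖ₑ)
      (hρ.enorm.pow_const _).aemeasurable ((hρ.enorm.pow_const _).mul hm).aemeasurable
    have h3 : ∀ a : ℝ≥0∞, (a ^ (1/2 : ℝ)) ^ 2 = a := fun a => by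
      rw [← ENNReal.rpow_natCast, ← ENNReal.rpow_mul]; norm_num
    simp only [← mul_assoc, ← sq, h3, mul_pow, hρ1, one_mul] at h2
    exact (pow_le_pow_left' h1 2).trans h2
  rw [← ENNReal.pow_le_pow_left_iff (n := 2) (by norm_num), eLpNorm_two_sq, eLpNorm_two_sq]
  calc _ ≤ ∫⁻ x, ∫⁻ t, ‖ρ t‖ₑ * ‖G (x - t)‖ₑ ^ 2 := lintegral_mono key
    _ = ∫⁻ t, ∫⁻ x, ‖ρ t‖ₑ * ‖G (x - t)‖ₑ ^ 2 := lintegral_lintegral_swap hprod.aemeasurable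
    _ = ∫⁻ t, ‖ρ t‖ₑ * ∫⁻ x, ‖G x‖ₑ ^ 2 := by
      congr 1; ext t
      rw [lintegral_const_mul, lintegral_sub_right_eq_self (fun x => ‖G x‖ₑ ^ 2)]
      exact (hGm.comp (measurable_id.sub measurable_const)).pow_const 2
    _ = _ := by rw [lintegral_mul_const _ hρ.enorm, hρ1, one_mul]

theorem lintegral_enorm_normed (φ : ContDiffBump (0 : R3)) :
    ∫⁻ x, ‖φ.normed volume x‖ₑ = 1 := by
  rw [← ofReal_integral_norm_eq_lintegral_enorm φ.integrable_normed]
  simp only [Real.norm_of_nonneg (φ.nonneg_normed _), φ.integral_normed, ENNReal.ofReal_one]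

/-- Mollifications converge in `L²`: `G` is replaced by a continuous compactly supported `ψ`, for
which the convergence is uniform on a fixed compact neighbourhood of the support. -/
theorem exists_eLpNorm_convolution_sub_le {F : Type*} [NormedAddCommGroup F] [NormedSpace ℝ F]
    [CompleteSpace F] {G : R3 → F} (hG : StronglyMeasurable G) (hG2 : MemLp G 2 volume)
    {η : ℝ≥0∞} (hη : η ≠ 0) :
    ∃ r : ℝ, 0 < r ∧ ∀ φ : ContDiffBump (0 : R3), φ.rOut ≤ r →
      eLpNorm (φ.normed volume ⋆[lsmul ℝ ℝ, volume] G - G) 2 volume ≤ η := by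
  have hη3 : η / 3 ≠ 0 := by simp [hη]
  obtain ⟨ψ, hψs, hψG, hψc, hψ2⟩ := hG2.exists_hasCompactSupport_eLpNorm_sub_le (by simp) hη3
  set S := Metric.cthickening 1 (tsupport ψ)
  have hS : IsCompact S := IsCompact.cthickening hψs
  obtain ⟨c, hc, hcS⟩ : ∃ c : ℝ, 0 < c ∧
      ENNReal.ofReal c * volume S ^ (1 / (2 : ℝ≥0∞).toReal) ≤ η / 3 := by
    have hfin : volume S ^ (1 / (2 : ℝ≥0∞).toReal) ≠ ⊤ :=
      ENNReal.rpow_ne_top_of_nonneg (by simp) hS.measure_lt_top.ne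
    obtain ⟨c, hc, hc'⟩ := ENNReal.exists_nnreal_pos_mul_lt hfin hη3
    exact ⟨c, hc, by simpa using hc'.le⟩
  obtain ⟨δ, hδ, hψu⟩ := Metric.uniformContinuous_iff.mp
    (hψs.uniformContinuous_of_continuous hψc) c hc
  refine ⟨min δ 1, by positivity, fun φ hφ => ?_⟩
  have hφδ : φ.rOut ≤ δ := hφ.trans (min_le_left _ _)
  have hφ1 : φ.rOut ≤ 1 := hφ.trans (min_le_right _ _)
  have hcψ : Continuous (φ.normed volume ⋆[lsmul ℝ ℝ, volume] ψ) :=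
    φ.hasCompactSupport_normed.continuous_convolution_left _ φ.continuous_normed
      hψc.locallyIntegrable
  have hm : StronglyMeasurable (G - ψ) := hG.sub hψc.stronglyMeasurable
  have e1 : φ.normed volume ⋆[lsmul ℝ ℝ, volume] (G - ψ)
      = φ.normed volume ⋆[lsmul ℝ ℝ, volume] G - φ.normed volume ⋆[lsmul ℝ ℝ, volume] ψ := by
    have h1 := (φ.hasCompactSupport_normed (μ := volume)).convolutionExists_left (lsmul ℝ ℝ)
      φ.continuous_normed (((hG2.sub hψ2).locallyIntegrable (by norm_num)))
    have h2 := (φ.hasCompactSupport_normed (μ := volume)).convolutionExists_left (lsmul ℝ ℝ)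
      φ.continuous_normed (hψc.locallyIntegrable (μ := (volume : Measure R3)))
    rw [eq_sub_iff_add_eq, ← h1.distrib_add h2, sub_add_cancel]
  have hb1 : eLpNorm (φ.normed volume ⋆[lsmul ℝ ℝ, volume] (G - ψ)) 2 volume ≤ η / 3 :=
    (eLpNorm_convolution_le φ.continuous_normed.measurable (lintegral_enorm_normed φ) hm).trans hψG
  have hb2 : eLpNorm (φ.normed volume ⋆[lsmul ℝ ℝ, volume] ψ - ψ) 2 volume ≤ η / 3 := by
    refine (eLpNorm_sub_le_of_dist_bdd volume (s := S) (by simp) hS.isClosed.measurableSet hc.le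
      (fun x => ?_) ?_ ?_).trans hcS
    · exact φ.dist_normed_convolution_le hψc.aestronglyMeasurable fun y hy =>
        (hψu ((Metric.mem_ball.mp hy).trans_le hφδ)).le
    · refine (support_convolution_subset _).trans ?_
      rintro _ ⟨a, ha, b, hb, rfl⟩
      rw [φ.support_normed_eq] at ha
      refine Metric.mem_cthickening_of_dist_le (a + b) b 1 _ (subset_tsupport _ hb) ?_
      simpa using (mem_ball_zero_iff.mp ha).le.trans hφ1
    · exact (subset_tsupport _).trans (Metric.self_subset_cthickening _)
  have e2 : φ.normed volume ⋆[lsmul ℝ ℝ, volume] G - G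
      = φ.normed volume ⋆[lsmul ℝ ℝ, volume] (G - ψ)
        + (φ.normed volume ⋆[lsmul ℝ ℝ, volume] ψ - ψ) - (G - ψ) := by
    rw [e1]; abel
  have hm1 : AEStronglyMeasurable (φ.normed volume ⋆[lsmul ℝ ℝ, volume] (G - ψ)) volume :=
    (φ.hasCompactSupport_normed.continuous_convolution_left _ φ.continuous_normed
      ((hG2.sub hψ2).locallyIntegrable (by norm_num))).aestronglyMeasurable
  have hm2 : AEStronglyMeasurable (φ.normed volume ⋆[lsmul ℝ ℝ, volume] ψ - ψ) volume :=
    (hcψ.sub hψc).aestronglyMeasurable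
  calc _ ≤ η / 3 + η / 3 + η / 3 := by
        rw [e2]
        refine (eLpNorm_sub_le (hm1.add hm2) hm.aestronglyMeasurable (by norm_num)).trans ?_
        exact add_le_add ((eLpNorm_add_le hm1 hm2 (by norm_num)).trans (add_le_add hb1 hb2)) hψG
    _ = η := ENNReal.add_thirds η

theorem gradient_coord (w : R3 → ℝ) (x : R3) (i : Fin 3) :
    gradient w x i = fderiv ℝ w x (EuclideanSpace.single i 1) := by
  rw [← inner_gradient_left, EuclideanSpace.inner_single_right]
  simp

/-- The gradient of a mollification of `u` is the mollification of the weak gradient of `u`; this is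
the definition of the weak gradient tested with `y ↦ ρ (x - y)`. -/
theorem gradient_convolution_weakGradient {u : Lp ℝ 2 (volume : Measure R3)}
    {g : Lp R3 2 (volume : Measure R3)} (hu : IsWeakGradient u g) {ρ : R3 → ℝ}
    (hρ : ContDiff ℝ ∞ ρ) (hρs : HasCompactSupport ρ) (x : R3) :
    gradient (ρ ⋆[lsmul ℝ ℝ, volume] u) x = (ρ ⋆[lsmul ℝ ℝ, volume] g) x := by
  have hul : LocallyIntegrable u (volume : Measure R3) :=
    (Lp.memLp u).locallyIntegrable (by norm_num)
  have hgl : LocallyIntegrable g (volume : Measure R3) :=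
    (Lp.memLp g).locallyIntegrable (by norm_num)
  have hρ1 : ContDiff ℝ 1 ρ := hρ.of_le (by simp)
  have hd := hρs.hasFDerivAt_convolution_left (lsmul ℝ ℝ) hρ1 hul x
  have hex : ConvolutionExistsAt (fderiv ℝ ρ) u x ((lsmul ℝ ℝ).precompL R3) volume :=
    (hρs.fderiv ℝ).convolutionExists_left _ (hρ1.continuous_fderiv one_ne_zero) hul x
  have hexg : ConvolutionExistsAt ρ g x (lsmul ℝ ℝ) volume :=
    hρs.convolutionExists_left _ hρ.continuous hgl x
  ext i
  rw [gradient_coord, hd.fderiv, convolution_def, ContinuousLinearMap.integral_apply hex.integrable]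
  have e2 : (ρ ⋆[lsmul ℝ ℝ, volume] g) x i = ∫ y, g y i * ρ (x - y) := by
    rw [convolution_def, ← integral_sub_left_eq_self _ volume x]
    have := (EuclideanSpace.proj i : R3 →L[ℝ] ℝ).integral_comp_comm
      (hexg.integrable.comp_sub_left x)
    refine this.symm.trans (integral_congr_ae (.of_forall fun y => ?_))
    simp [mul_comm]
  have ht1 : ContDiff ℝ ∞ fun y => ρ (x - y) := hρ.comp (contDiff_const.sub contDiff_id)
  have ht2 : HasCompactSupport fun y => ρ (x - y) :=
    hρs.comp_homeomorph (Homeomorph.subLeft x)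
  have hf : ∀ y, fderiv ℝ (fun y => ρ (x - y)) y (EuclideanSpace.single i 1)
      = - fderiv ℝ ρ (x - y) (EuclideanSpace.single i 1) := by
    intro y
    have h1 := ((hρ.differentiable (by simp)) (x - y)).hasFDerivAt.comp y
      ((hasFDerivAt_const x y).sub (hasFDerivAt_id y))
    have h2 : fderiv ℝ (fun y => ρ (x - y)) y = _ := h1.fderiv
    rw [h2]; simp
  have h3 := hu _ ht1 ht2 i
  rw [e2, ← neg_eq_iff_eq_neg.mpr h3, ← integral_sub_left_eq_self _ volume x, ← integral_neg]
  congr 1; ext y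
  rw [hf]
  simp [mul_comm]

/-! ### Approximation by test functions -/

theorem norm_gradient (w : R3 → ℝ) (x : R3) : ‖gradient w x‖ = ‖fderiv ℝ w x‖ := by
  simp [gradient]

theorem continuous_gradient {w : R3 → ℝ} (hw : ContDiff ℝ ∞ w) : Continuous (gradient w) :=
  (InnerProductSpace.toDual ℝ R3).symm.continuous.comp (hw.continuous_fderiv (by simp))

theorem hasCompactSupport_gradient {w : R3 → ℝ} (hw : HasCompactSupport w) :
    HasCompactSupport (gradient w) :=
  (hw.fderiv ℝ).comp_left (g := (InnerProductSpace.toDual ℝ R3).symm) (map_zero _)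

theorem memLp_gradient {w : R3 → ℝ} (hw : ContDiff ℝ ∞ w) (hs : HasCompactSupport w) :
    MemLp (gradient w) 2 (volume : Measure R3) :=
  (continuous_gradient hw).memLp_of_hasCompactSupport (hasCompactSupport_gradient hs)

/-- Multiplication with a wide cutoff `χ(x / n)` changes the `L²` norms of a smooth function and of
its gradient arbitrarily little. -/
theorem exists_cutoff {w : R3 → ℝ} (hw : ContDiff ℝ ∞ w) (hw2 : MemLp w 2 volume)
    {η : ℝ≥0∞} (hη : η ≠ 0) :
    ∃ φ : R3 → ℝ, ContDiff ℝ ∞ φ ∧ HasCompactSupport φ ∧ eLpNorm (φ - w) 2 volume ≤ η ∧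
      eLpNorm (gradient φ) 2 volume ≤ eLpNorm (gradient w) 2 volume + η := by
  let χ : ContDiffBump (0 : R3) := ⟨1, 2, one_pos, one_lt_two⟩
  have hχ : ContDiff ℝ ∞ χ := χ.contDiff
  obtain ⟨C, hC⟩ := (χ.hasCompactSupport.fderiv ℝ).exists_bound_of_continuous
    (hχ.continuous_fderiv (by simp))
  have hC0 : 0 ≤ C := (norm_nonneg _).trans (hC 0)
  let s : ℕ → ℝ := fun n => 1 / ((n : ℝ) + 1)
  have hs : Tendsto s atTop (𝓝 0) := tendsto_one_div_add_atTop_nhds_zero_nat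
  have hspos : ∀ n, 0 < s n := fun n => by positivity
  let c : ℕ → R3 → ℝ := fun n x => χ (s n • x)
  have hc : ∀ n, ContDiff ℝ ∞ (c n) := fun n => hχ.comp (contDiff_const_smul (s n))
  have hcs : ∀ n, HasCompactSupport (c n) := fun n =>
    χ.hasCompactSupport.comp_smul (hspos n).ne'
  have hc0 : ∀ n x, 0 ≤ c n x := fun n x => χ.nonneg
  have hc1 : ∀ n x, c n x ≤ 1 := fun n x => χ.le_one
  have hdc : ∀ n x, ‖fderiv ℝ (c n) x‖ ≤ C * s n := by
    intro n x
    have h1 := (hχ.differentiable (by simp) (s n • x)).hasFDerivAt.comp x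
      ((hasFDerivAt_id x).const_smul (s n))
    have h2 : fderiv ℝ (c n) x = _ := h1.fderiv
    rw [h2]
    refine (ContinuousLinearMap.opNorm_comp_le _ _).trans ?_
    refine mul_le_mul (hC _) ?_ (norm_nonneg _) hC0
    rw [norm_smul, Real.norm_of_nonneg (hspos n).le]
    exact mul_le_of_le_one_right (hspos n).le ContinuousLinearMap.norm_id_le
  have hlim : ∀ x, Tendsto (fun n => c n x) atTop (𝓝 1) := by
    intro x
    have h1 : Tendsto (fun n => s n • x) atTop (𝓝 ((0 : ℝ) • x)) := hs.smul_const x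
    have h2 := (hχ.continuous.tendsto _).comp h1
    rw [zero_smul] at h2
    rw [χ.one_of_mem_closedBall (by simp [χ.rIn_pos.le])] at h2
    exact h2
  have hL2 : Tendsto (fun n => eLpNorm (c n * w - w) 2 volume) atTop (𝓝 0) := by
    have h := tendsto_lintegral_of_dominated_convergence
      (F := fun n x => ‖(c n * w - w) x‖ₑ ^ 2) (f := fun _ => 0) (μ := (volume : Measure R3))
      (fun x => ‖w x‖ₑ ^ 2)
      (fun n => ((((hc n).mul hw).sub hw).continuous.enorm).measurable.pow_const 2)
      (fun n => .of_forall fun x => ?_) ?_ (.of_forall fun x => ?_)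
    · rw [lintegral_zero] at h
      simp_rw [← eLpNorm_two_sq] at h
      have h' := (ENNReal.continuous_rpow_const (y := 1/2)).tendsto _ |>.comp h
      refine (h'.congr fun n => ?_).trans (by simp)
      simp only [Function.comp]
      rw [← ENNReal.rpow_natCast, ← ENNReal.rpow_mul]; norm_num
    · refine pow_le_pow_left' ?_ 2
      rw [enorm_le_iff_norm_le]
      have : (c n * w - w) x = (c n x - 1) * w x := by simp [sub_mul]
      rw [this, norm_mul]
      refine mul_le_of_le_one_left (norm_nonneg _) ?_
      rw [Real.norm_eq_abs, abs_le]
      constructor <;> linarith [hc0 n x, hc1 n x]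
    · rw [← eLpNorm_two_sq]
      exact ENNReal.pow_ne_top hw2.2.ne
    · have h1 : Tendsto (fun n => (c n * w - w) x) atTop (𝓝 0) := by
        have := ((hlim x).mul_const (w x)).sub_const (w x)
        simpa using this
      have h2 := ENNReal.Tendsto.pow (n := 2) h1.enorm
      simpa using h2
  have hB : Tendsto (fun n => ENNReal.ofReal (C * s n) * eLpNorm w 2 volume) atTop (𝓝 0) := by
    have h1 : Tendsto (fun n => ENNReal.ofReal (C * s n)) atTop (𝓝 0) := by
      have := ENNReal.tendsto_ofReal (hs.const_mul C)
      simpa using this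
    have := ENNReal.Tendsto.mul_const h1 (Or.inr hw2.2.ne)
    simpa using this
  have hη' : 0 < η := pos_iff_ne_zero.mpr hη
  obtain ⟨n, hn1, hn2⟩ := ((hL2.eventually_le_const hη').and (hB.eventually_le_const hη')).exists
  refine ⟨c n * w, (hc n).mul hw, (hcs n).mul_right, hn1, ?_⟩
  have hgm : AEStronglyMeasurable (gradient w) (volume : Measure R3) :=
    (continuous_gradient hw).aestronglyMeasurable
  have hpt : ∀ x, ‖gradient (c n * w) x‖ ≤ ‖‖gradient w x‖ + (C * s n) * ‖w x‖‖ := by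
    intro x
    have h1 : fderiv ℝ (c n * w) x = c n x • fderiv ℝ w x + w x • fderiv ℝ (c n) x :=
      fderiv_mul ((hc n).differentiable (by simp) x) (hw.differentiable (by simp) x)
    rw [Real.norm_of_nonneg (by have := hspos n; positivity), norm_gradient, norm_gradient, h1]
    refine (norm_add_le _ _).trans ?_
    rw [norm_smul, norm_smul, Real.norm_of_nonneg (hc0 n x), mul_comm (C * s n)]
    exact add_le_add (mul_le_of_le_one_left (norm_nonneg _) (hc1 n x))
      (mul_le_mul_of_nonneg_left (hdc n x) (norm_nonneg _))
  calc _ ≤ eLpNorm (fun x => ‖gradient w x‖ + (C * s n) * ‖w x‖) 2 volume :=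
        eLpNorm_mono hpt
    _ ≤ eLpNorm (fun x => ‖gradient w x‖) 2 volume
        + eLpNorm ((C * s n) • fun x => ‖w x‖) 2 volume :=
        eLpNorm_add_le hgm.norm (hw2.1.norm.const_mul _) (by norm_num)
    _ ≤ _ := by
        rw [eLpNorm_norm, eLpNorm_const_smul, eLpNorm_norm]
        gcongr
        refine le_trans (le_of_eq ?_) hn2
        rw [Real.enorm_of_nonneg (by have := hspos n; positivity)]

/-- Test functions approximate `u` in `L²` with almost no increase of the gradient norm. Strong
convergence of the gradients is not needed below. -/
theorem IsWeakGradient.exists_test_approx {u : Lp ℝ 2 (volume : Measure R3)}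
    {g : Lp R3 2 (volume : Measure R3)} (hu : IsWeakGradient u g) {η : ℝ≥0∞} (hη : η ≠ 0) :
    ∃ φ : R3 → ℝ, ContDiff ℝ ∞ φ ∧ HasCompactSupport φ ∧ eLpNorm (φ - ⇑u) 2 volume ≤ η ∧
      eLpNorm (gradient φ) 2 volume ≤ eLpNorm g 2 volume + η := by
  have hη2 : η / 2 ≠ 0 := by simp [hη]
  obtain ⟨r, hr, h⟩ := exists_eLpNorm_convolution_sub_le (Lp.stronglyMeasurable u) (Lp.memLp u) hη2
  let χ : ContDiffBump (0 : R3) := ⟨r / 2, r, by positivity, by linarith⟩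
  have hu1 := h χ le_rfl
  have hul : LocallyIntegrable u (volume : Measure R3) :=
    (Lp.memLp u).locallyIntegrable (by norm_num)
  have hρ : ContDiff ℝ ∞ (χ.normed volume) := χ.contDiff_normed
  have hw : ContDiff ℝ ∞ (χ.normed volume ⋆[lsmul ℝ ℝ, volume] u) :=
    χ.hasCompactSupport_normed.contDiff_convolution_left _ hρ hul
  have hw2 : MemLp (χ.normed volume ⋆[lsmul ℝ ℝ, volume] u) 2 volume :=
    ⟨hw.continuous.aestronglyMeasurable, (eLpNorm_convolution_le χ.continuous_normed.measurable
      (lintegral_enorm_normed χ) (Lp.stronglyMeasurable u)).trans_lt (Lp.memLp u).2⟩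
  have hg : gradient (χ.normed volume ⋆[lsmul ℝ ℝ, volume] u)
      = χ.normed volume ⋆[lsmul ℝ ℝ, volume] g :=
    funext fun x => gradient_convolution_weakGradient hu hρ χ.hasCompactSupport_normed x
  obtain ⟨φ, h1, h2, h3, h4⟩ := exists_cutoff hw hw2 hη2
  refine ⟨φ, h1, h2, ?_, h4.trans ?_⟩
  · have e : φ - ⇑u = (φ - χ.normed volume ⋆[lsmul ℝ ℝ, volume] u)
        + (χ.normed volume ⋆[lsmul ℝ ℝ, volume] u - ⇑u) := by abel
    rw [e, ← ENNReal.add_halves η]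
    exact (eLpNorm_add_le (h1.continuous.sub hw.continuous).aestronglyMeasurable
      (hw2.1.sub (Lp.memLp u).1) (by norm_num)).trans (add_le_add h3 hu1)
  · rw [hg]
    exact add_le_add (eLpNorm_convolution_le χ.continuous_normed.measurable
      (lintegral_enorm_normed χ) (Lp.stronglyMeasurable g)) ENNReal.half_le_self

/-! ### Weak limits and weak gradients -/

/-- Bounded sequences in a Hilbert space converge weakly along every ultrafilter. -/
theorem exists_weak_limit {Z : Type*} [NormedAddCommGroup Z] [InnerProductSpace ℝ Z]
    [CompleteSpace Z] {x : ℕ → Z} {M : ℝ} (hx : ∀ k, ‖x k‖ ≤ M) (U : Ultrafilter ℕ) :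
    ∃ y : Z, ∀ z, Tendsto (fun k => inner ℝ (x k) z) U (𝓝 (inner ℝ y z)) := by
  let T : Z → WeakDual ℝ Z := fun z => StrongDual.toWeakDual (InnerProductSpace.toDual ℝ Z z)
  have hK := WeakDual.isCompact_closedBall (𝕜 := ℝ) (0 : StrongDual ℝ Z) M
  obtain ⟨a, -, ha⟩ := isCompact_iff_ultrafilter_le_nhds.mp hK (U.map (T ∘ x)) (by
    rw [Ultrafilter.coe_map, le_principal_iff, mem_map]
    filter_upwards with k
    simpa [T] using hx k)
  refine ⟨(InnerProductSpace.toDual ℝ Z).symm (WeakDual.toStrongDual a), fun z => ?_⟩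
  have h1 := ((WeakDual.eval_continuous z).tendsto a).comp (show Tendsto (T ∘ x) U (𝓝 a) from ha)
  rw [InnerProductSpace.toDual_symm_apply]
  exact h1

theorem inner_toLp_single {g : Lp R3 2 (volume : Measure R3)} {φ : R3 → ℝ} (i : Fin 3)
    (h : MemLp (fun x => EuclideanSpace.single i (φ x)) 2 (volume : Measure R3)) :
    inner ℝ g (h.toLp _) = ∫ x, g x i * φ x := by
  rw [L2.inner_def]
  refine integral_congr_ae ?_
  filter_upwards [h.coeFn_toLp] with x hx
  rw [hx, EuclideanSpace.inner_single_right]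
  simp [mul_comm]

/-- The weak gradient is closed under strong convergence of the functions and weak convergence of
the gradients. -/
theorem IsWeakGradient.of_tendsto {U : Filter ℕ} [U.NeBot] {a : ℕ → Lp ℝ 2 (volume : Measure R3)}
    {p : ℕ → Lp R3 2 (volume : Measure R3)} {a' : Lp ℝ 2 (volume : Measure R3)}
    {p' : Lp R3 2 (volume : Measure R3)} (h : ∀ k, IsWeakGradient (a k) (p k))
    (ha : Tendsto a U (𝓝 a'))
    (hp : ∀ z, Tendsto (fun k => inner ℝ (p k) z) U (𝓝 (inner ℝ p' z))) :
    IsWeakGradient a' p' := by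
  intro φ h1 h2 i
  have hφ := memLp_test h1 h2
  have hs : MemLp (fun x => EuclideanSpace.single i (φ x)) 2 (volume : Measure R3) := by
    refine (hφ.continuousLinearMap_comp (ContinuousLinearMap.toSpanSingleton ℝ
      (EuclideanSpace.single i (1 : ℝ)))).congr_norm ?_ (.of_forall fun x => by simp [norm_smul])
    have : (fun x => EuclideanSpace.single i (φ x))
        = fun x => φ x • (EuclideanSpace.single i (1 : ℝ) : R3) := by
      ext x j; simp
    rw [this]
    exact (h1.continuous.smul continuous_const).aestronglyMeasurable
  have hd := memLp_fderiv_test h1 h2 (EuclideanSpace.single i 1)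
  have e1 : ∀ b : Lp ℝ 2 (volume : Measure R3), inner ℝ b (hd.toLp _)
      = ∫ x, b x * fderiv ℝ φ x (EuclideanSpace.single i 1) := by
    intro b
    rw [L2.inner_def]
    refine integral_congr_ae ?_
    filter_upwards [hd.coeFn_toLp] with x hx
    rw [hx]; simp [mul_comm]
  have l1 : Tendsto (fun k => inner ℝ (a k) (hd.toLp _)) U (𝓝 (inner ℝ a' (hd.toLp _))) :=
    ha.inner tendsto_const_nhds
  have l2 := (hp (hs.toLp _)).neg
  rw [← e1, ← inner_toLp_single i hs]
  refine tendsto_nhds_unique l1 (l2.congr fun k => ?_)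
  rw [e1, inner_toLp_single i hs, h k φ h1 h2 i]

theorem IsWeakGradient.unique {u : Lp ℝ 2 (volume : Measure R3)}
    {g h : Lp R3 2 (volume : Measure R3)} (hg : IsWeakGradient u g) (hh : IsWeakGradient u h) :
    g = h := by
  have key : ∀ i : Fin 3, ∀ᵐ x ∂(volume : Measure R3), g x i = h x i := by
    intro i
    refine ae_eq_of_integral_contDiff_smul_eq ((memLp_coord g i).locallyIntegrable (by norm_num))
      ((memLp_coord h i).locallyIntegrable (by norm_num)) fun φ h1 h2 => ?_
    have := neg_injective ((hg φ h1 h2 i).symm.trans (hh φ h1 h2 i))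
    simpa [mul_comm] using this
  refine Lp.ext ?_
  filter_upwards [ae_all_iff.mpr key] with x hx
  exact PiLp.ext hx

theorem isWeakGradient_test {φ : R3 → ℝ} (h1 : ContDiff ℝ ∞ φ) (h2 : HasCompactSupport φ) :
    IsWeakGradient ((memLp_test h1 h2).toLp φ) ((memLp_gradient h1 h2).toLp (gradient φ)) := by
  intro ψ h3 h4 i
  have e1 : ∫ x, (memLp_test h1 h2).toLp φ x * fderiv ℝ ψ x (EuclideanSpace.single i 1)
      = ∫ x, φ x * fderiv ℝ ψ x (EuclideanSpace.single i 1) := by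
    refine integral_congr_ae ?_
    filter_upwards [(memLp_test h1 h2).coeFn_toLp] with x hx
    rw [hx]
  have e2 : ∫ x, (memLp_gradient h1 h2).toLp (gradient φ) x i * ψ x
      = ∫ x, fderiv ℝ φ x (EuclideanSpace.single i 1) * ψ x := by
    refine integral_congr_ae ?_
    filter_upwards [(memLp_gradient h1 h2).coeFn_toLp] with x hx
    rw [hx, gradient_coord]
  rw [e1, e2]
  exact integral_mul_fderiv_eq_neg_fderiv_mul_of_integrable
    ((memLp_fderiv_test h1 h2 _).integrable_mul (memLp_test h3 h4))
    ((memLp_test h1 h2).integrable_mul (memLp_fderiv_test h3 h4 _))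
    ((memLp_test h1 h2).integrable_mul (memLp_test h3 h4))
    (fun x _ => h1.differentiable (by simp) x) (fun x _ => h3.differentiable (by simp) x)

/-- A smooth approximation `(t + √(t² + δ²) - δ) / 2` of the positive part `max t 0`. It vanishes at
`0`, so that composition with it preserves compact support, and its derivative lies in `[0, 1]`. -/
noncomputable def smoothPos (δ t : ℝ) : ℝ := (t + √(t ^ 2 + δ ^ 2) - δ) / 2

theorem abs_smoothPos_sub_le {δ : ℝ} (hδ : 0 < δ) (t : ℝ) : |smoothPos δ t - t ⊔ 0| ≤ δ := by
  have h1 : |t| ≤ √(t ^ 2 + δ ^ 2) := Real.abs_le_sqrt (by nlinarith)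
  have h2 : √(t ^ 2 + δ ^ 2) ≤ |t| + δ := by
    rw [Real.sqrt_le_left (by positivity)]
    nlinarith [sq_abs t, abs_nonneg t]
  have h3 : t ⊔ 0 = (t + |t|) / 2 := by
    rcases le_total 0 t with h | h
    · rw [abs_of_nonneg h, sup_eq_left.mpr h]; ring
    · rw [abs_of_nonpos h, sup_eq_right.mpr h]; ring
  rw [smoothPos, h3, abs_le]
  constructor <;> linarith

theorem contDiff_smoothPos {δ : ℝ} (hδ : 0 < δ) : ContDiff ℝ ∞ (smoothPos δ) := by
  have : ContDiff ℝ ∞ fun t : ℝ => √(t ^ 2 + δ ^ 2) :=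
    ((contDiff_id.pow 2).add contDiff_const).sqrt fun t => by positivity
  exact ((contDiff_id.add this).sub contDiff_const).div_const 2

theorem deriv_smoothPos_mem {δ : ℝ} (hδ : 0 < δ) (t : ℝ) :
    0 ≤ deriv (smoothPos δ) t ∧ deriv (smoothPos δ) t ≤ 1 := by
  have hpos : 0 < t ^ 2 + δ ^ 2 := by positivity
  have h0 : HasDerivAt (smoothPos δ) ((1 + t / √(t ^ 2 + δ ^ 2)) / 2) t := by
    have h1 : HasDerivAt (fun t : ℝ => t ^ 2 + δ ^ 2) (2 * t) t := by
      simpa using (hasDerivAt_pow 2 t).add_const (δ ^ 2)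
    have h2 := (((hasDerivAt_id t).add (h1.sqrt hpos.ne')).sub_const δ).div_const 2
    refine h2.congr_deriv ?_
    have := (Real.sqrt_pos.mpr hpos).ne'
    field_simp
  have h1 : |t| ≤ √(t ^ 2 + δ ^ 2) := Real.abs_le_sqrt (by nlinarith)
  have hs := Real.sqrt_pos.mpr hpos
  have h2 : -1 ≤ t / √(t ^ 2 + δ ^ 2) := by
    rw [le_div_iff₀ hs]; linarith [neg_abs_le t]
  have h3 : t / √(t ^ 2 + δ ^ 2) ≤ 1 := by
    rw [div_le_iff₀ hs]; linarith [le_abs_self t]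
  rw [h0.deriv]
  constructor <;> linarith

/-- A smooth approximation `a` of the positive part of a test function `φ`, with `∇a = c ∇φ` for
some `0 ≤ c ≤ 1`. -/
theorem exists_smooth_split {φ : R3 → ℝ} (h1 : ContDiff ℝ ∞ φ) (h2 : HasCompactSupport φ)
    {η : ℝ≥0∞} (hη : η ≠ 0) :
    ∃ a : R3 → ℝ, ContDiff ℝ ∞ a ∧ HasCompactSupport a ∧
      eLpNorm (a - fun x => φ x ⊔ 0) 2 volume ≤ η ∧
      ∃ c : R3 → ℝ, (∀ x, 0 ≤ c x ∧ c x ≤ 1) ∧ ∀ x, gradient a x = c x • gradient φ x := by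
  have hS : IsCompact (tsupport φ) := h2
  obtain ⟨c, hc, hcS⟩ : ∃ c : ℝ, 0 < c ∧
      ENNReal.ofReal c * volume (tsupport φ) ^ (1 / (2 : ℝ≥0∞).toReal) ≤ η := by
    have hfin : volume (tsupport φ) ^ (1 / (2 : ℝ≥0∞).toReal) ≠ ⊤ :=
      ENNReal.rpow_ne_top_of_nonneg (by simp) hS.measure_lt_top.ne
    obtain ⟨c, hc, hc'⟩ := ENNReal.exists_nnreal_pos_mul_lt hfin hη
    exact ⟨c, hc, by simpa using hc'.le⟩
  have hG := contDiff_smoothPos hc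
  have hG0 : smoothPos c 0 = 0 := by simp [smoothPos, Real.sqrt_sq hc.le]
  refine ⟨smoothPos c ∘ φ, hG.comp h1, h2.comp_left hG0, ?_,
    fun x => deriv (smoothPos c) (φ x), fun x => deriv_smoothPos_mem hc _, fun x => ?_⟩
  · refine (eLpNorm_sub_le_of_dist_bdd volume (s := tsupport φ) (by simp)
      hS.isClosed.measurableSet hc.le (fun x => ?_) ?_ ?_).trans hcS
    · exact abs_smoothPos_sub_le hc (φ x)
    · refine (Function.support_comp_subset hG0 φ).trans (subset_tsupport _)
    · intro x hx
      refine subset_tsupport _ fun h0 => hx ?_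
      simp [h0]
  · have hd := ((hG.differentiable (by simp)) (φ x)).hasDerivAt.comp_hasFDerivAt x
      ((h1.differentiable (by simp)) x).hasFDerivAt
    rw [gradient, gradient, hd.fderiv]
    simp

/-! ### The positive part and the Sobolev inequality -/

/-- The inequality `0 ≤ ⟪P, Q - P⟫`, that is `‖P‖² + ‖Q - P‖² ≤ ‖Q‖²`, passes to weak limits when
the norms of the `Q k` do not exceed the norm of their limit asymptotically. -/
theorem inner_sub_nonneg_of_weak_limit {Z : Type*} [NormedAddCommGroup Z] [InnerProductSpace ℝ Z]
    {U : Filter ℕ} [U.NeBot] {P Q : ℕ → Z} {p q : Z} {c : ℕ → ℝ}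
    (hP : ∀ z, Tendsto (fun k => inner ℝ (P k) z) U (𝓝 (inner ℝ p z)))
    (hQ : ∀ z, Tendsto (fun k => inner ℝ (Q k) z) U (𝓝 (inner ℝ q z)))
    (hc : ∀ k, ‖Q k‖ ≤ c k) (hcq : Tendsto c U (𝓝 ‖q‖))
    (h : ∀ k, 0 ≤ inner ℝ (P k) (Q k - P k)) : 0 ≤ inner ℝ p (q - p) := by
  have l1 : Tendsto (fun k => inner ℝ (P k) p + inner ℝ (Q k - P k) (q - p)) U
      (𝓝 (‖p‖ ^ 2 + ‖q - p‖ ^ 2)) := by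
    have h1 := (hP p).add ((hQ (q - p)).sub (hP (q - p)))
    simp only [← inner_sub_left, real_inner_self_eq_norm_sq] at h1
    exact h1
  have l2 : Tendsto (fun k => (c k ^ 2 + (‖p‖ ^ 2 + ‖q - p‖ ^ 2)) / 2) U
      (𝓝 ((‖q‖ ^ 2 + (‖p‖ ^ 2 + ‖q - p‖ ^ 2)) / 2)) :=
    ((hcq.pow 2).add_const _).div_const 2
  have key := le_of_tendsto_of_tendsto' l1 l2 fun k => by
    have e1 := real_inner_le_norm (P k) p
    have e2 := real_inner_le_norm (Q k - P k) (q - p)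
    have e3 : ‖Q k‖ ^ 2 = ‖P k‖ ^ 2 + 2 * inner ℝ (P k) (Q k - P k) + ‖Q k - P k‖ ^ 2 := by
      rw [← norm_add_sq_real, add_sub_cancel]
    have e4 : ‖Q k‖ ^ 2 ≤ c k ^ 2 := pow_le_pow_left₀ (norm_nonneg _) (hc k) 2
    nlinarith [h k, sq_nonneg (‖P k‖ - ‖p‖), sq_nonneg (‖Q k - P k‖ - ‖q - p‖)]
  have e3 : ‖q‖ ^ 2 = ‖p‖ ^ 2 + 2 * inner ℝ p (q - p) + ‖q - p‖ ^ 2 := by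
    rw [← norm_add_sq_real, add_sub_cancel]
  linarith

theorem norm_toLp_sub_le {F : Type*} [NormedAddCommGroup F] {f : R3 → F}
    (hf : MemLp f 2 (volume : Measure R3)) (u : Lp F 2 (volume : Measure R3)) {η : ℝ} (hη : 0 ≤ η)
    (h : eLpNorm (f - ⇑u) 2 volume ≤ ENNReal.ofReal η) : ‖hf.toLp f - u‖ ≤ η := by
  conv_lhs => rw [← Lp.toLp_coeFn u (Lp.memLp u), ← MemLp.toLp_sub, Lp.norm_toLp]
  exact ENNReal.toReal_le_of_le_ofReal hη h

/-- The positive part of an `H¹` function lies in `H¹`, and `|∇u⁺|₂² ≤ ∫ ∇u · ∇u⁺`. (Equality holds,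
but is not needed.) The inequality is clear for smooth approximations of the positive part of a
test function and passes to the weak limit. -/
theorem IsWeakGradient.sup_zero {u : Lp ℝ 2 (volume : Measure R3)}
    {g : Lp R3 2 (volume : Measure R3)} (hu : IsWeakGradient u g) :
    ∃ p, IsWeakGradient (u ⊔ 0) p ∧ 0 ≤ inner ℝ p (g - p) := by
  let s : ℕ → ℝ := fun n => 1 / ((n : ℝ) + 1)
  have hs : Tendsto s atTop (𝓝 0) := tendsto_one_div_add_atTop_nhds_zero_nat
  have hspos : ∀ n, 0 < s n := fun n => by positivity
  have hs1 : ∀ n, s n ≤ 1 := fun n => by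
    simp only [s]; rw [div_le_one (by positivity)]; linarith [n.cast_nonneg (α := ℝ)]
  have hs0 : ∀ n, ENNReal.ofReal (s n) ≠ 0 := fun n => by simpa using hspos n
  choose φ hφ hφs hφu hφg using fun n => hu.exists_test_approx (hs0 n)
  choose a ha has haφ c hc hac using fun n => exists_smooth_split (hφ n) (hφs n) (hs0 n)
  let Φ : ℕ → Lp ℝ 2 (volume : Measure R3) := fun n => (memLp_test (hφ n) (hφs n)).toLp (φ n)
  let A : ℕ → Lp ℝ 2 (volume : Measure R3) := fun n => (memLp_test (ha n) (has n)).toLp (a n)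
  let Q : ℕ → Lp R3 2 (volume : Measure R3) :=
    fun n => (memLp_gradient (hφ n) (hφs n)).toLp (gradient (φ n))
  let P : ℕ → Lp R3 2 (volume : Measure R3) :=
    fun n => (memLp_gradient (ha n) (has n)).toLp (gradient (a n))
  have hΦu : ∀ n, ‖Φ n - u‖ ≤ s n := fun n => norm_toLp_sub_le _ u (hspos n).le (hφu n)
  have hΦ : Tendsto Φ atTop (𝓝 u) :=
    tendsto_iff_norm_sub_tendsto_zero.mpr
      (squeeze_zero (fun _ => norm_nonneg _) hΦu hs)
  have hAΦ : ∀ n, ‖A n - Φ n ⊔ 0‖ ≤ s n := fun n => by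
    refine norm_toLp_sub_le _ _ (hspos n).le ((eLpNorm_congr_ae ?_).trans_le (haφ n))
    filter_upwards [Lp.coeFn_sup (Φ n) 0, (memLp_test (hφ n) (hφs n)).coeFn_toLp,
      Lp.coeFn_zero ℝ 2 (volume : Measure R3)] with x h1 h2 h3
    simp only [Pi.sub_apply, h1, Pi.sup_apply, h3, Pi.zero_apply]
    rw [show Φ n x = φ n x from h2]
  have hA : Tendsto A atTop (𝓝 (u ⊔ 0)) := by
    have h1 : Tendsto (fun n => Φ n ⊔ 0) atTop (𝓝 (u ⊔ 0)) := hΦ.sup_nhds tendsto_const_nhds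
    have h2 : Tendsto (fun n => A n - Φ n ⊔ 0) atTop (𝓝 0) :=
      tendsto_zero_iff_norm_tendsto_zero.mpr (squeeze_zero (fun _ => norm_nonneg _) hAΦ hs)
    simpa using h2.add h1
  have hQn : ∀ n, ‖Q n‖ ≤ ‖g‖ + s n := fun n => by
    refine (Lp.norm_toLp _ _).trans_le (ENNReal.toReal_le_of_le_ofReal
      (add_nonneg (norm_nonneg _) (hspos n).le) ((hφg n).trans_eq ?_))
    rw [ENNReal.ofReal_add (norm_nonneg _) (hspos n).le, Lp.norm_def,
      ENNReal.ofReal_toReal (Lp.eLpNorm_ne_top g)]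
  have hPQ : ∀ n, 0 ≤ inner ℝ (P n) (Q n - P n) := fun n => by
    rw [L2.inner_def]
    refine integral_nonneg_of_ae ?_
    filter_upwards [(memLp_gradient (ha n) (has n)).coeFn_toLp,
      (memLp_gradient (hφ n) (hφs n)).coeFn_toLp, Lp.coeFn_sub (Q n) (P n)] with x h1 h2 h3
    rw [h3, Pi.sub_apply, show P n x = _ from h1, show Q n x = _ from h2, hac, inner_sub_right,
      real_inner_smul_left, real_inner_smul_left, real_inner_smul_right]
    have := real_inner_self_nonneg (x := gradient (φ n) x)
    have h4 := mul_nonneg (mul_nonneg (hc n x).1 (sub_nonneg.mpr (hc n x).2)) this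
    simp only [Pi.zero_apply]
    linarith
  have hPn : ∀ n, ‖P n‖ ≤ ‖g‖ + 1 := fun n => by
    have h1 := hPQ n
    rw [inner_sub_right, real_inner_self_eq_norm_sq] at h1
    have h2 := real_inner_le_norm (P n) (Q n)
    rcases (norm_nonneg (P n)).eq_or_lt with h0 | h0
    · rw [← h0]; positivity
    · have : ‖P n‖ ≤ ‖Q n‖ := le_of_mul_le_mul_left (by nlinarith) h0
      linarith [hQn n, hs1 n]
  have hQn' : ∀ n, ‖Q n‖ ≤ ‖g‖ + 1 := fun n => by linarith [hQn n, hs1 n]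
  have hU := Nat.hyperfilter_le_atTop
  let U : Ultrafilter ℕ := hyperfilter ℕ
  obtain ⟨p, hp⟩ := exists_weak_limit hPn U
  obtain ⟨q, hq⟩ := exists_weak_limit hQn' U
  have hpw : IsWeakGradient (u ⊔ 0) p := IsWeakGradient.of_tendsto (U := U)
    (fun n => isWeakGradient_test (ha n) (has n)) (hA.mono_left hU) hp
  have hqw : IsWeakGradient u q := IsWeakGradient.of_tendsto (U := U)
    (fun n => isWeakGradient_test (hφ n) (hφs n)) (hΦ.mono_left hU) hq
  obtain rfl : g = q := hu.unique hqw
  refine ⟨p, hpw, inner_sub_nonneg_of_weak_limit (U := U) hp hq hQn ?_ hPQ⟩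
  have := (hs.mono_left hU).const_add ‖g‖
  rwa [add_zero] at this

/-- The Sobolev inequality `|u|₆ ≤ C |∇u|₂`, extended from test functions by Fatou's lemma. -/
theorem IsWeakGradient.exists_sobolev :
    ∃ C : NNReal, ∀ (u : Lp ℝ 2 (volume : Measure R3)) (g : Lp R3 2 (volume : Measure R3)),
      IsWeakGradient u g → eLpNorm u 6 volume ≤ C * eLpNorm g 2 volume := by
  refine ⟨eLpNormLESNormFDerivOfEqInnerConst (volume : Measure R3) (2 : NNReal), fun u g hu => ?_⟩
  set C := eLpNormLESNormFDerivOfEqInnerConst (volume : Measure R3) (2 : NNReal)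
  let s : ℕ → ℝ := fun n => 1 / ((n : ℝ) + 1)
  have hs : Tendsto s atTop (𝓝 0) := tendsto_one_div_add_atTop_nhds_zero_nat
  have hspos : ∀ n, 0 < s n := fun n => by positivity
  have hs0 : ∀ n, ENNReal.ofReal (s n) ≠ 0 := fun n => by simpa using hspos n
  have hsE : Tendsto (fun n => ENNReal.ofReal (s n)) atTop (𝓝 0) := by
    simpa using ENNReal.tendsto_ofReal hs
  choose φ hφ hφs hφu hφg using fun n => hu.exists_test_approx (hs0 n)
  have hGNS : ∀ n, eLpNorm (φ n) 6 volume ≤ C * (eLpNorm g 2 volume + ENNReal.ofReal (s n)) := by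
    intro n
    have h := eLpNorm_le_eLpNorm_fderiv_of_eq_inner (volume : Measure R3)
      ((hφ n).of_le (by simp)) (hφs n) (p := 2) (p' := 6) (by norm_num)
      (by simp) (by simp; norm_num)
    have e : eLpNorm (fderiv ℝ (φ n)) 2 volume = eLpNorm (gradient (φ n)) 2 volume :=
      eLpNorm_congr_norm_ae (.of_forall fun x => (norm_gradient _ x).symm)
    refine (h.trans_eq ?_).trans (mul_le_mul_right (hφg n) _)
    rw [← e]; rfl
  have hm : TendstoInMeasure volume φ atTop u :=
    tendstoInMeasure_of_tendsto_eLpNorm (p := 2) (by simp)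
      (fun n => (hφ n).continuous.aestronglyMeasurable) (Lp.aestronglyMeasurable u)
      (tendsto_of_tendsto_of_tendsto_of_le_of_le tendsto_const_nhds hsE (fun _ => zero_le) hφu)
  obtain ⟨ns, hns, hae⟩ := hm.exists_seq_tendsto_ae
  refine (Lp.eLpNorm_lim_le_liminf_eLpNorm (f := fun n => φ (ns n))
    (fun n => (hφ _).continuous.aestronglyMeasurable) u hae).trans ?_
  have hlim : Tendsto (fun n => C * (eLpNorm g 2 volume + ENNReal.ofReal (s (ns n)))) atTop
      (𝓝 (C * eLpNorm g 2 volume)) := by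
    have h1 := (hsE.comp hns.tendsto_atTop).const_add (eLpNorm g 2 volume)
    rw [add_zero] at h1
    exact ENNReal.Tendsto.const_mul h1 (Or.inr ENNReal.coe_ne_top)
  rw [← hlim.liminf_eq]
  exact liminf_le_liminf (.of_forall fun n => hGNS (ns n))

/-! ### The space of radial functions -/

theorem isWeakGradient_radGrad (u : H1rad) : IsWeakGradient (radFn u) (radGrad u) := u.2.1

theorem H1rad.inner_eq (u v : H1rad) :
    inner ℝ u v = inner ℝ (radFn u) (radFn v) + inner ℝ (radGrad u) (radGrad v) :=
  WithLp.prod_inner_apply _ _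

theorem norm_sq_eq_radFn_radGrad (u : H1rad) : ‖u‖ ^ 2 = ‖radFn u‖ ^ 2 + ‖radGrad u‖ ^ 2 :=
  WithLp.prod_norm_sq_eq_of_L2 _

theorem norm_radFn_le (u : H1rad) : ‖radFn u‖ ≤ ‖u‖ :=
  le_of_sq_le_sq (by rw [norm_sq_eq_radFn_radGrad]; nlinarith [sq_nonneg ‖radGrad u‖]) (norm_nonneg _)

theorem norm_radGrad_le (u : H1rad) : ‖radGrad u‖ ≤ ‖u‖ :=
  le_of_sq_le_sq (by rw [norm_sq_eq_radFn_radGrad]; nlinarith [sq_nonneg ‖radFn u‖]) (norm_nonneg _)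

theorem radFn_add (u v : H1rad) : radFn (u + v) = radFn u + radFn v := rfl
theorem radFn_sub (u v : H1rad) : radFn (u - v) = radFn u - radFn v := rfl
theorem radFn_smul (c : ℝ) (u : H1rad) : radFn (c • u) = c • radFn u := rfl
theorem radGrad_sub (u v : H1rad) : radGrad (u - v) = radGrad u - radGrad v := rfl

theorem H1rad.exists_mk {a : Lp ℝ 2 (volume : Measure R3)} {p : Lp R3 2 (volume : Measure R3)}
    (h : IsWeakGradient a p) (hr : IsRadial a) : ∃ v : H1rad, radFn v = a ∧ radGrad v = p :=
  ⟨⟨WithLp.toLp 2 (a, p), h, hr⟩, rfl, rfl⟩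

theorem IsRadial.sup_zero {u : Lp ℝ 2 (volume : Measure R3)} (hu : IsRadial u) :
    IsRadial (u ⊔ 0) := by
  obtain ⟨ρ, hρ⟩ := hu
  refine ⟨fun r => ρ r ⊔ 0, ?_⟩
  filter_upwards [hρ, Lp.coeFn_sup u 0, Lp.coeFn_zero ℝ 2 (volume : Measure R3)] with x h1 h2 h3
  rw [h2, Pi.sup_apply, h3, h1]; rfl

theorem coeFn_sup_zero (u : Lp ℝ 2 (volume : Measure R3)) :
    ∀ᵐ x ∂(volume : Measure R3), (u ⊔ 0 : Lp ℝ 2 (volume : Measure R3)) x = u x ⊔ 0 := by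
  filter_upwards [Lp.coeFn_sup u 0, Lp.coeFn_zero ℝ 2 (volume : Measure R3)] with x h2 h3
  rw [h2, Pi.sup_apply, h3]; rfl

theorem inner_posPart_negPart_eq_zero (u : Lp ℝ 2 (volume : Measure R3)) :
    inner ℝ (u ⊔ 0) (u - u ⊔ 0) = 0 := by
  rw [L2.inner_def]
  refine integral_eq_zero_of_ae ?_
  filter_upwards [coeFn_sup_zero u, Lp.coeFn_sub u (u ⊔ 0)] with x h1 h2
  rw [h2, Pi.sub_apply, h1]
  rcases le_total 0 (u x) with h | h
  · rw [sup_eq_left.mpr h]; simp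
  · rw [sup_eq_right.mpr h]; simp

theorem H1rad.exists_posPart (u : H1rad) : ∃ v : H1rad, radFn v = radFn u ⊔ 0 := by
  obtain ⟨p, hp, -⟩ := (isWeakGradient_radGrad u).sup_zero
  obtain ⟨v, hv, -⟩ := H1rad.exists_mk hp (IsRadial.sup_zero u.2.2)
  exact ⟨v, hv⟩

theorem H1rad.inner_posPart_sub_nonneg {u v : H1rad} (hv : radFn v = radFn u ⊔ 0) :
    0 ≤ inner ℝ v (u - v) := by
  obtain ⟨p, hp, h0⟩ := (isWeakGradient_radGrad u).sup_zero
  have hvp : radGrad v = p := by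
    have := (isWeakGradient_radGrad v)
    rw [hv] at this
    exact this.unique hp
  rw [H1rad.inner_eq, radFn_sub, radGrad_sub, hv, hvp, inner_posPart_negPart_eq_zero, zero_add]
  exact h0

theorem H1rad.norm_posPart_sq_le {u v : H1rad} (hv : radFn v = radFn u ⊔ 0) :
    ‖v‖ ^ 2 ≤ inner ℝ u v := by
  have := H1rad.inner_posPart_sub_nonneg hv
  rw [inner_sub_right, real_inner_self_eq_norm_sq, real_inner_comm] at this
  linarith

theorem H1rad.norm_negPart_sq_le {u v : H1rad} (hv : radFn v = radFn u ⊔ 0) :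
    ‖u - v‖ ^ 2 ≤ inner ℝ u (u - v) := by
  have := H1rad.inner_posPart_sub_nonneg hv
  rw [← real_inner_self_eq_norm_sq, inner_sub_left u v]
  linarith

theorem H1rad.norm_posPart_le {u v : H1rad} (hv : radFn v = radFn u ⊔ 0) : ‖v‖ ≤ ‖u‖ := by
  have h1 := H1rad.norm_posPart_sq_le hv
  have h2 := real_inner_le_norm u v
  rcases (norm_nonneg v).eq_or_lt with h0 | h0
  · rw [← h0]; positivity
  · exact le_of_mul_le_mul_right (by nlinarith) h0

/-- The embedding of `H¹` into `L⁴`, from `|u|₄⁴ ≤ |u|₂ |u|₆³`. -/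
theorem H1rad.exists_eLpNorm_four_le : ∃ C : NNReal, ∀ u : H1rad,
    eLpNorm (radFn u) 4 volume ≤ C * ENNReal.ofReal ‖u‖ := by
  obtain ⟨C, hC⟩ := IsWeakGradient.exists_sobolev
  refine ⟨C ⊔ 1, fun u => ?_⟩
  set D : ℝ≥0∞ := ((C ⊔ 1 : NNReal) : ℝ≥0∞) with hD
  have hD1 : 1 ≤ D := by simp [hD]
  have hCD : (C : ℝ≥0∞) ≤ D := by simp [hD]
  clear_value D
  have hm : Measurable fun x => ‖radFn u x‖ₑ := (Lp.stronglyMeasurable (radFn u)).enorm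
  set N : ℝ≥0∞ := ENNReal.ofReal ‖u‖ with hN
  have h2 : eLpNorm (radFn u) 2 volume ≤ N := by
    rw [← Lp.enorm_def]
    rw [← ofReal_norm]
    exact ENNReal.ofReal_le_ofReal (norm_radFn_le u)
  have h6 : eLpNorm (radFn u) 6 volume ≤ D * N := by
    refine (hC _ _ (isWeakGradient_radGrad u)).trans ?_
    rw [← Lp.enorm_def]
    refine mul_le_mul' hCD ?_
    rw [← ofReal_norm]
    exact ENNReal.ofReal_le_ofReal (norm_radGrad_le u)
  clear_value N
  have e6 := eLpNorm_nnreal_pow_eq_lintegral (μ := volume) (f := radFn u) (p := 6) (by norm_num)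
  have e4 := eLpNorm_nnreal_pow_eq_lintegral (μ := volume) (f := radFn u) (p := 4) (by norm_num)
  have e2 := eLpNorm_two_sq volume (radFn u)
  have cs := lintegral_mul_sq_le volume (f := fun x => ‖radFn u x‖ₑ)
    (g := fun x => ‖radFn u x‖ₑ ^ 3) hm.aemeasurable (hm.pow_const 3).aemeasurable
  simp only [← pow_succ', ← pow_mul] at cs
  norm_num at cs e6 e4
  have e6' : eLpNorm (radFn u) 6 volume ^ 6 = ∫⁻ x, ‖radFn u x‖ₑ ^ 6 := by
    exact_mod_cast e6
  have e4' : eLpNorm (radFn u) 4 volume ^ 4 = ∫⁻ x, ‖radFn u x‖ₑ ^ 4 := by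
    exact_mod_cast e4
  rw [← e6', ← e4', ← e2] at cs
  rw [← ENNReal.pow_le_pow_left_iff (n := 8) (by norm_num)]
  calc eLpNorm (radFn u) 4 volume ^ 8 = (eLpNorm (radFn u) 4 volume ^ 4) ^ 2 := by ring
    _ ≤ _ := cs
    _ ≤ N ^ 2 * (D * N) ^ 6 :=
      mul_le_mul' (pow_le_pow_left' h2 2) (pow_le_pow_left' h6 6)
    _ = D ^ 6 * N ^ 8 := by ring
    _ ≤ D ^ 8 * N ^ 8 := by
      have : D ^ 6 ≤ D ^ 8 := pow_le_pow_right₀ hD1 (by norm_num)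
      gcongr
    _ = (D * N) ^ 8 := (mul_pow _ _ _).symm

/-! ### Newton potentials and the Hartree form -/

theorem holderTriple_four_four_two : ENNReal.HolderTriple 4 4 2 := by
  refine ⟨?_⟩
  rw [← two_mul, show (4 : ℝ≥0∞) = 2 * 2 by norm_num, ENNReal.mul_inv (by simp) (by simp),
    ← mul_assoc, ENNReal.mul_inv_cancel (by simp) (by simp), one_mul]

/-- A constant `C` with `|u|₄ ≤ C ‖u‖` for all `u` in `H¹_rad(ℝ³)`. -/
noncomputable def sobolevConst : ℝ := (H1rad.exists_eLpNorm_four_le.choose : ℝ)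

theorem sobolevConst_nonneg : 0 ≤ sobolevConst := NNReal.coe_nonneg _

theorem eLpNorm_four_radFn_le (u : H1rad) :
    eLpNorm (radFn u) 4 volume ≤ ENNReal.ofReal (sobolevConst * ‖u‖) := by
  rw [ENNReal.ofReal_mul sobolevConst_nonneg, sobolevConst, ENNReal.ofReal_coe_nnreal]
  exact H1rad.exists_eLpNorm_four_le.choose_spec u

theorem eLpNorm_two_radFn_le (u : H1rad) :
    eLpNorm (radFn u) 2 volume ≤ ENNReal.ofReal ‖u‖ := by
  rw [← Lp.enorm_def, ← ofReal_norm]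
  exact ENNReal.ofReal_le_ofReal (norm_radFn_le u)

theorem memLp_four_radFn (u : H1rad) : MemLp (radFn u) 4 (volume : Measure R3) :=
  ⟨Lp.aestronglyMeasurable _, (eLpNorm_four_radFn_le u).trans_lt ENNReal.ofReal_lt_top⟩

theorem memLp_mul_radFn (u v : H1rad) :
    MemLp (fun x => radFn u x * radFn v x) 2 (volume : Measure R3) :=
  have := holderTriple_four_four_two
  (memLp_four_radFn v).mul (memLp_four_radFn u)

theorem integrable_mul_radFn (u v : H1rad) :
    Integrable (fun x => radFn u x * radFn v x) (volume : Measure R3) :=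
  (Lp.memLp (radFn u)).integrable_mul (Lp.memLp (radFn v))

theorem eLpNorm_mul_radFn_le (u v : H1rad) :
    eLpNorm (fun x => radFn u x * radFn v x) 2 volume
      ≤ ENNReal.ofReal (sobolevConst ^ 2 * (‖u‖ * ‖v‖)) := by
  have := holderTriple_four_four_two
  refine (eLpNorm_smul_le_mul_eLpNorm (p := 4) (q := 4) (r := 2) (f := radFn v) (φ := radFn u)
    (Lp.aestronglyMeasurable _) (Lp.aestronglyMeasurable _)).trans ?_
  refine (mul_le_mul' (eLpNorm_four_radFn_le u) (eLpNorm_four_radFn_le v)).trans_eq ?_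
  rw [← ENNReal.ofReal_mul (mul_nonneg sobolevConst_nonneg (norm_nonneg _))]
  congr 1; ring

theorem integral_abs_mul_le {f g : R3 → ℝ} (hf : MemLp f 2 volume) (hg : MemLp g 2 volume)
    {a b : ℝ} (ha : 0 ≤ a) (hb : 0 ≤ b) (hfa : eLpNorm f 2 volume ≤ ENNReal.ofReal a)
    (hgb : eLpNorm g 2 volume ≤ ENNReal.ofReal b) : ∫ x, |f x * g x| ≤ a * b := by
  have h := eLpNorm_smul_le_mul_eLpNorm (p := 2) (q := 2) (r := 1) (f := g) (φ := f) hg.1 hf.1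
  have h2 := h.trans ((mul_le_mul' hfa hgb).trans_eq (ENNReal.ofReal_mul ha).symm)
  rw [eLpNorm_one_eq_lintegral_enorm] at h2
  have h3 := integral_norm_eq_lintegral_enorm (hf.1.mul hg.1)
  simp only [Real.norm_eq_abs, Pi.mul_apply] at h3
  rw [h3]
  exact ENNReal.toReal_le_of_le_ofReal (by positivity) h2

theorem integral_abs_mul_radFn_le (u v : H1rad) :
    ∫ x, |radFn u x * radFn v x| ≤ ‖u‖ * ‖v‖ :=
  integral_abs_mul_le (Lp.memLp _) (Lp.memLp _) (norm_nonneg _) (norm_nonneg _)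
    (eLpNorm_two_radFn_le u) (eLpNorm_two_radFn_le v)

theorem integrable_mul_four_radFn (u v w z : H1rad) :
    Integrable (fun x => (radFn u x * radFn v x) * (radFn w x * radFn z x))
      (volume : Measure R3) :=
  (memLp_mul_radFn u v).integrable_mul (memLp_mul_radFn w z)

theorem integral_abs_mul_four_radFn_le (u v w z : H1rad) :
    ∫ x, |(radFn u x * radFn v x) * (radFn w x * radFn z x)|
      ≤ sobolevConst ^ 4 * (‖u‖ * ‖v‖ * (‖w‖ * ‖z‖)) := by
  refine (integral_abs_mul_le (memLp_mul_radFn u v) (memLp_mul_radFn w z) (by positivity)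
    (by positivity) (eLpNorm_mul_radFn_le u v) (eLpNorm_mul_radFn_le w z)).trans_eq ?_
  ring

/-- The Newton kernel `1 / (4π|z|)` (with value `0` at the origin, a null set). -/
noncomputable def newtonKernel (z : R3) : ℝ := 1 / (4 * Real.pi * ‖z‖)

theorem newtonKernel_nonneg (z : R3) : 0 ≤ newtonKernel z := by
  have := Real.pi_pos
  unfold newtonKernel; positivity

theorem measurable_newtonKernel : Measurable newtonKernel :=
  measurable_const.div (measurable_const.mul measurable_norm)

theorem memLp_newtonKernel_near :
    MemLp ((Metric.ball (0 : R3) 1).indicator newtonKernel) 2 volume := by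
  rw [memLp_two_iff_integrable_sq
    (measurable_newtonKernel.indicator measurableSet_ball).aestronglyMeasurable]
  have h1 : IntegrableOn (fun x : R3 => (1 / (4 * Real.pi * ‖x‖)) ^ 2)
      (Metric.ball 0 1) volume := by
    refine (integrableOn_fun_norm_addHaar volume
      (f := fun r : ℝ => (1 / (4 * Real.pi * r)) ^ 2)).mpr ?_
    have h : IntegrableOn (fun _ : ℝ => (1 / (4 * Real.pi)) ^ 2) (Set.Ioo 0 1) volume :=
      integrableOn_const (by simp)
    refine h.congr_fun (fun y hy => ?_) measurableSet_Ioo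
    have := hy.1.ne'
    have := Real.pi_pos.ne'
    simp
    field_simp
  refine ((integrable_indicator_iff measurableSet_ball).mpr h1).congr (.of_forall fun x => ?_)
  by_cases hx : x ∈ Metric.ball (0 : R3) 1 <;> simp only [Set.indicator_of_mem, hx,
    Set.indicator_of_notMem, not_false_eq_true] <;> simp [newtonKernel]

theorem newtonKernel_far_le {z : R3} (hz : z ∉ Metric.ball (0 : R3) 1) : newtonKernel z ≤ 1 := by
  have h1 : 1 ≤ ‖z‖ := by simpa using hz
  have := Real.pi_gt_three
  rw [newtonKernel, div_le_one (by nlinarith)]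
  nlinarith

/-- The Newton potential `1/(4π|·|) * p` of a density `p`; `newtonPotential u` is the case
`p = u²`. -/
noncomputable def densityPotential (p : R3 → ℝ) (x : R3) : ℝ := ∫ y, newtonKernel (x - y) * p y

/-- The `L²` norm of the Newton kernel on the unit ball. -/
noncomputable def nearKernelNorm : ℝ :=
  (eLpNorm ((Metric.ball (0 : R3) 1).indicator newtonKernel) 2 volume).toReal

/-- The Newton potential of an `L¹ ∩ L²` density is bounded: the kernel is square integrable on the
unit ball and at most `1` outside. -/
theorem newtonKernel_mul_integrable_and_le {p : R3 → ℝ} (hp : Integrable p volume)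
    (hp2 : MemLp p 2 volume) {b : ℝ} (hb : 0 ≤ b)
    (hpb : eLpNorm p 2 volume ≤ ENNReal.ofReal b) (x : R3) :
    Integrable (fun y => newtonKernel (x - y) * p y) volume ∧
      |densityPotential p x| ≤ nearKernelNorm * b + ∫ y, |p y| := by
  set k1 : R3 → ℝ := (Metric.ball (0 : R3) 1).indicator newtonKernel
  set k2 : R3 → ℝ := (Metric.ball (0 : R3) 1)ᶜ.indicator newtonKernel
  have hk : ∀ z, newtonKernel z = k1 z + k2 z := fun z =>
    (congrFun (Set.indicator_self_add_compl _ _) z).symm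
  have mp := volume.measurePreserving_sub_left x (G := R3)
  have h1 : MemLp (fun y => k1 (x - y)) 2 volume := memLp_newtonKernel_near.comp_measurePreserving mp
  have h1n : eLpNorm (fun y => k1 (x - y)) 2 volume ≤ ENNReal.ofReal nearKernelNorm := by
    refine (eLpNorm_comp_measurePreserving memLp_newtonKernel_near.1 mp).trans_le ?_
    rw [nearKernelNorm, ENNReal.ofReal_toReal memLp_newtonKernel_near.2.ne]
  have i1 : Integrable (fun y => k1 (x - y) * p y) volume := h1.integrable_mul hp2
  have hk2 : ∀ z, |k2 z| ≤ 1 := fun z => by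
    by_cases hz : z ∈ Metric.ball (0 : R3) 1
    · simp [k2, hz]
    · rw [show k2 z = newtonKernel z from Set.indicator_of_mem (s := (Metric.ball (0 : R3) 1)ᶜ) hz _,
        abs_of_nonneg (newtonKernel_nonneg z)]
      exact newtonKernel_far_le hz
  have hk2m : Measurable k2 := measurable_newtonKernel.indicator measurableSet_ball.compl
  have i2 : Integrable (fun y => k2 (x - y) * p y) volume :=
    hp.bdd_mul (c := 1) (hk2m.comp (measurable_const.sub measurable_id)).aestronglyMeasurable
      (.of_forall fun y => hk2 _)
  have e : (fun y => newtonKernel (x - y) * p y)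
      = fun y => k1 (x - y) * p y + k2 (x - y) * p y := by
    ext y; rw [hk, add_mul]
  refine ⟨e ▸ i1.add i2, ?_⟩
  rw [densityPotential, e, integral_add i1 i2]
  refine (abs_add_le _ _).trans (add_le_add ?_ ?_)
  · exact abs_integral_le_integral_abs.trans
      (integral_abs_mul_le h1 hp2 ENNReal.toReal_nonneg hb h1n hpb)
  · refine abs_integral_le_integral_abs.trans (integral_mono i2.abs hp.abs fun y => ?_)
    rw [abs_mul]
    exact mul_le_of_le_one_left (abs_nonneg _) (hk2 _)

theorem stronglyMeasurable_densityPotential {p : R3 → ℝ} (hp : Measurable p) :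
    StronglyMeasurable (densityPotential p) := by
  refine StronglyMeasurable.integral_prod_right (f := fun x y => newtonKernel (x - y) * p y) ?_
  exact ((measurable_newtonKernel.comp (measurable_fst.sub measurable_snd)).mul
    (hp.comp measurable_snd)).stronglyMeasurable

/-- The four-linear form `∫∫ u(y) v(y) w(x) z(x) / (4π|x - y|) dy dx`; on the diagonal it is
`∫ φ_u u²`. -/
noncomputable def hartreeForm (u v w z : H1rad) : ℝ :=
  ∫ x, densityPotential (fun y => radFn u y * radFn v y) x * (radFn w x * radFn z x)

/-- A bound for the four-linear Hartree form on `H¹_rad(ℝ³)`. -/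
noncomputable def hartreeConst : ℝ := nearKernelNorm * sobolevConst ^ 2 + 1

theorem densityPotential_radFn (u v : H1rad) (x : R3) :
    Integrable (fun y => newtonKernel (x - y) * (radFn u y * radFn v y)) volume ∧
      |densityPotential (fun y => radFn u y * radFn v y) x| ≤ hartreeConst * (‖u‖ * ‖v‖) := by
  have h := newtonKernel_mul_integrable_and_le (integrable_mul_radFn u v) (memLp_mul_radFn u v)
    (by positivity) (eLpNorm_mul_radFn_le u v) x
  refine ⟨h.1, h.2.trans ?_⟩
  have := integral_abs_mul_radFn_le u v
  rw [hartreeConst]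
  linarith

theorem measurable_radFn (u : H1rad) : Measurable (radFn u) :=
  (Lp.stronglyMeasurable (radFn u)).measurable

theorem integrable_hartree (u v w z : H1rad) :
    Integrable (fun x => densityPotential (fun y => radFn u y * radFn v y) x
      * (radFn w x * radFn z x)) volume :=
  (integrable_mul_radFn w z).bdd_mul
    (stronglyMeasurable_densityPotential
      ((measurable_radFn u).mul (measurable_radFn v))).aestronglyMeasurable
    (.of_forall fun x => (densityPotential_radFn u v x).2)

theorem hartreeForm_le (u v w z : H1rad) :
    |hartreeForm u v w z| ≤ hartreeConst * (‖u‖ * ‖v‖ * (‖w‖ * ‖z‖)) := by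
  have hC : 0 ≤ hartreeConst := by
    have : 0 ≤ nearKernelNorm := ENNReal.toReal_nonneg
    unfold hartreeConst; positivity
  calc |hartreeForm u v w z|
      ≤ ∫ x, hartreeConst * (‖u‖ * ‖v‖) * |radFn w x * radFn z x| := by
        refine abs_integral_le_integral_abs.trans (integral_mono (integrable_hartree u v w z).abs
          ((integrable_mul_radFn w z).abs.const_mul _) fun x => ?_)
        rw [abs_mul]
        exact mul_le_mul_of_nonneg_right (densityPotential_radFn u v x).2 (abs_nonneg _)
    _ ≤ hartreeConst * (‖u‖ * ‖v‖) * (‖w‖ * ‖z‖) := by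
        rw [integral_const_mul]
        exact mul_le_mul_of_nonneg_left (integral_abs_mul_radFn_le w z) (by positivity)
    _ = _ := by ring

theorem hartreeForm_comm_left (u v w z : H1rad) : hartreeForm u v w z = hartreeForm v u w z := by
  simp only [hartreeForm, mul_comm (radFn u _)]

theorem hartreeForm_comm_right (u v w z : H1rad) : hartreeForm u v w z = hartreeForm u v z w := by
  simp only [hartreeForm, mul_comm (radFn w _)]

theorem hartreeForm_add_left (u u' v w z : H1rad) :
    hartreeForm (u + u') v w z = hartreeForm u v w z + hartreeForm u' v w z := by
  have h : densityPotential (fun y => radFn (u + u') y * radFn v y)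
      = fun x => densityPotential (fun y => radFn u y * radFn v y) x
        + densityPotential (fun y => radFn u' y * radFn v y) x := by
    ext x
    rw [densityPotential, densityPotential, densityPotential,
      ← integral_add (densityPotential_radFn u v x).1 (densityPotential_radFn u' v x).1]
    refine integral_congr_ae ?_
    filter_upwards [Lp.coeFn_add (radFn u) (radFn u')] with y hy
    rw [radFn_add, hy, Pi.add_apply]; ring
  rw [hartreeForm, h, hartreeForm, hartreeForm,
    ← integral_add (integrable_hartree u v w z) (integrable_hartree u' v w z)]
  simp only [add_mul]

theorem hartreeForm_smul_left (c : ℝ) (u v w z : H1rad) :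
    hartreeForm (c • u) v w z = c * hartreeForm u v w z := by
  have h : densityPotential (fun y => radFn (c • u) y * radFn v y)
      = fun x => c * densityPotential (fun y => radFn u y * radFn v y) x := by
    ext x
    rw [densityPotential, densityPotential, ← integral_const_mul]
    refine integral_congr_ae ?_
    filter_upwards [Lp.coeFn_smul c (radFn u)] with y hy
    rw [radFn_smul, hy, Pi.smul_apply, smul_eq_mul]; ring
  rw [hartreeForm, h, hartreeForm, ← integral_const_mul]
  simp only [mul_assoc]

theorem hartreeForm_add_right (u v w w' z : H1rad) :
    hartreeForm u v (w + w') z = hartreeForm u v w z + hartreeForm u v w' z := by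
  rw [hartreeForm, hartreeForm, hartreeForm,
    ← integral_add (integrable_hartree u v w z) (integrable_hartree u v w' z)]
  refine integral_congr_ae ?_
  filter_upwards [Lp.coeFn_add (radFn w) (radFn w')] with y hy
  rw [radFn_add, hy, Pi.add_apply]; ring

theorem hartreeForm_smul_right (c : ℝ) (u v w z : H1rad) :
    hartreeForm u v (c • w) z = c * hartreeForm u v w z := by
  rw [hartreeForm, hartreeForm, ← integral_const_mul]
  refine integral_congr_ae ?_
  filter_upwards [Lp.coeFn_smul c (radFn w)] with y hy
  rw [radFn_smul, hy, Pi.smul_apply, smul_eq_mul]; ring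

/-! ### Smoothness of the Hartree term -/

/-- The restriction of a bounded four-linear form to the diagonal is continuously differentiable.
The symmetries `u ↔ v` and `w ↔ z` suffice to write the derivative with two terms. The form lives on
an abstract space so that the instances of `H1rad` have to be unfolded only once. -/
theorem exists_fderiv_quartic {X : Type*} [NormedAddCommGroup X] [NormedSpace ℝ X]
    (B : X → X → X → X → ℝ) (C : ℝ)
    (add_left : ∀ u u' v w z, B (u + u') v w z = B u v w z + B u' v w z)
    (smul_left : ∀ (c : ℝ) u v w z, B (c • u) v w z = c * B u v w z)
    (add_right : ∀ u v w w' z, B u v (w + w') z = B u v w z + B u v w' z)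
    (smul_right : ∀ (c : ℝ) u v w z, B u v (c • w) z = c * B u v w z)
    (comm_left : ∀ u v w z, B u v w z = B v u w z)
    (comm_right : ∀ u v w z, B u v w z = B u v z w)
    (bound : ∀ u v w z, |B u v w z| ≤ C * (‖u‖ * ‖v‖ * (‖w‖ * ‖z‖))) :
    ∃ D : X → X →L[ℝ] ℝ, Continuous D ∧ (∀ u, HasFDerivAt (fun u => B u u u u) (D u) u) ∧
      ∀ u v, D u v = 2 * B u v u u + 2 * B u u u v := by
  let M : ContinuousMultilinearMap ℝ (fun _ : Fin 4 => X) ℝ := MultilinearMap.mkContinuous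
    (MultilinearMap.mk' (fun m : Fin 4 → X => B (m 0) (m 1) (m 2) (m 3))
      (fun m i x y => by
        fin_cases i <;> simp [Function.update]
        · exact add_left x y (m 1) (m 2) (m 3)
        · rw [comm_left, add_left, comm_left x, comm_left y]
        · exact add_right (m 0) (m 1) x y (m 3)
        · rw [comm_right, add_right, comm_right _ _ x, comm_right _ _ y])
      (fun m i c x => by
        fin_cases i <;> simp [Function.update]
        · exact smul_left c x (m 1) (m 2) (m 3)
        · rw [comm_left, smul_left, comm_left x]
        · exact smul_right c (m 0) (m 1) x (m 3)
        · rw [comm_right, smul_right, comm_right _ _ x]))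
    C (fun m => by
      have := bound (m 0) (m 1) (m 2) (m 3)
      rw [Fin.prod_univ_four, mul_assoc (‖m 0‖ * ‖m 1‖)]
      exact this)
  have hM : ∀ m, M m = B (m 0) (m 1) (m 2) (m 3) := fun m => rfl
  let δ : X →L[ℝ] Fin 4 → X := ContinuousLinearMap.pi fun _ : Fin 4 => ContinuousLinearMap.id ℝ X
  let D : X → X →L[ℝ] ℝ := fun u => (M.linearDeriv fun _ => u).comp δ
  have hD : ∀ u, HasFDerivAt (fun u => B u u u u) (D u) u := fun u =>
    HasFDerivAt.comp (g := M) (f := δ) u (M.hasFDerivAt fun _ => u) δ.hasFDerivAt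
  refine ⟨D, ?_, hD, fun u v => ?_⟩
  · have h : ContDiff ℝ 1 fun u => B u u u u := M.contDiff.comp δ.contDiff
    rw [show D = fderiv ℝ fun u => B u u u u from funext fun u => (hD u).fderiv.symm]
    exact h.continuous_fderiv one_ne_zero
  · have h : D u v = ∑ i, M (Function.update (fun _ => u) i v) :=
      M.linearDeriv_apply (fun _ => u) (fun _ => v)
    rw [h, Fin.sum_univ_four]
    simp only [hM]
    simp [Function.update]
    rw [comm_left v u, comm_right u u v u]
    ring

theorem exists_fderiv_hartree : ∃ D : H1rad → H1rad →L[ℝ] ℝ, Continuous D ∧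
    (∀ u, HasFDerivAt (fun u => ∫ x, newtonPotential (radFn u) x * radFn u x ^ 2) (D u) u) ∧
      ∀ u v, D u v = 2 * hartreeForm u v u u + 2 * hartreeForm u u u v := by
  have h := exists_fderiv_quartic hartreeForm hartreeConst hartreeForm_add_left
    hartreeForm_smul_left hartreeForm_add_right hartreeForm_smul_right hartreeForm_comm_left
    hartreeForm_comm_right hartreeForm_le
  obtain ⟨D, hDc, hD, hDa⟩ := h
  refine ⟨D, hDc, fun u => (hD u).congr_of_eventuallyEq (.of_forall fun u => ?_), hDa⟩
  simp only [hartreeForm, newtonPotential, densityPotential, newtonKernel, sq]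

theorem hartreeForm_nonneg {u v w z : H1rad} (h1 : ∀ᵐ x, 0 ≤ radFn u x * radFn v x)
    (h2 : ∀ᵐ x, 0 ≤ radFn w x * radFn z x) : 0 ≤ hartreeForm u v w z := by
  refine integral_nonneg_of_ae ?_
  filter_upwards [h2] with x hx
  refine mul_nonneg (integral_nonneg_of_ae ?_) hx
  filter_upwards [h1] with y hy
  exact mul_nonneg (newtonKernel_nonneg _) hy

/-! ### Pointwise estimates on the nonlinearity -/

/-- The weight `|t| + |t|³` against which the nonlinearity is measured: it matches the `L²` and the
`L⁴` bounds available in `H¹`. -/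
def cubicWeight (t : ℝ) : ℝ := |t| + |t| ^ 3

theorem cubicWeight_nonneg (t : ℝ) : 0 ≤ cubicWeight t := by unfold cubicWeight; positivity

theorem cubicWeight_le {a b K : ℝ} (hK : 1 ≤ K) (h : |a| ≤ K * |b|) :
    cubicWeight a ≤ K ^ 3 * cubicWeight b := by
  have h3 : |a| ^ 3 ≤ (K * |b|) ^ 3 := pow_le_pow_left₀ (abs_nonneg _) h 3
  have hK3 : K ≤ K ^ 3 := le_self_pow₀ hK (by norm_num)
  have : K * |b| ≤ K ^ 3 * |b| := mul_le_mul_of_nonneg_right hK3 (abs_nonneg _)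
  unfold cubicWeight
  rw [mul_pow] at h3
  linarith

namespace AsymptoticallyCubic

variable {f : ℝ → ℝ}

theorem map_zero (hf : AsymptoticallyCubic f) : f 0 = 0 := by
  have := hf.odd 0
  rw [neg_zero] at this
  linarith

theorem mul_self_le (hf : AsymptoticallyCubic f) (t : ℝ) : f t * t ≤ t ^ 4 := by
  rcases eq_or_ne t 0 with rfl | ht
  · simp
  · have h := hf.lt_one t ht
    have h4 : 0 < t ^ 4 := by positivity
    have e : f t * t = f t / t ^ 3 * t ^ 4 := by field_simp
    rw [e]
    nlinarith

/-- Near the origin `f(t) - t³` is small compared with the weight. -/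
theorem exists_near (hf : AsymptoticallyCubic f) {ε : ℝ} (hε : 0 < ε) :
    ∃ δ > 0, ∀ t, |t| ≤ δ → |f t - t ^ 3| ≤ ε * cubicWeight t := by
  obtain ⟨δ, hδ, h⟩ := Metric.tendsto_nhdsWithin_nhds.mp hf.zero_limit (ε / 2) (by positivity)
  refine ⟨min (δ / 2) (min 1 (ε / 2)), by positivity, fun t ht => ?_⟩
  have h1 : |t| ≤ δ / 2 := ht.trans (min_le_left _ _)
  have h2 : |t| ≤ 1 := ht.trans ((min_le_right _ _).trans (min_le_left _ _))
  have h3 : |t| ≤ ε / 2 := ht.trans ((min_le_right _ _).trans (min_le_right _ _))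
  rcases eq_or_ne t 0 with rfl | h0
  · simp [hf.map_zero, cubicWeight]
  have hft : |f t| ≤ ε / 2 * |t| := by
    have := (h (x := t) (by simpa using h0) (by rw [dist_zero_right, Real.norm_eq_abs]; linarith)).le
    rw [dist_zero_right, Real.norm_eq_abs, abs_div, div_le_iff₀ (abs_pos.mpr h0)] at this
    exact this
  have ht3 : |t ^ 3| ≤ ε / 2 * |t| := by
    rw [abs_pow]
    have : |t| ^ 2 ≤ |t| := by nlinarith [abs_nonneg t]
    nlinarith [abs_nonneg t]
  have h5 : 0 ≤ ε * |t| ^ 3 := by positivity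
  refine (abs_sub _ _).trans ?_
  unfold cubicWeight
  linarith

/-- Near infinity `f(t) - t³` is small compared with the weight. -/
theorem exists_far (hf : AsymptoticallyCubic f) {ε : ℝ} (hε : 0 < ε) :
    ∃ R > 0, ∀ t, R ≤ |t| → |f t - t ^ 3| ≤ ε * cubicWeight t := by
  obtain ⟨R, h⟩ := Filter.eventually_atTop.mp
    (Metric.tendsto_nhds.mp hf.infinity_limit ε hε)
  have key : ∀ t, max R 1 ≤ t → |f t - t ^ 3| ≤ ε * cubicWeight t := by
    intro t ht
    have ht0 : 0 < t := lt_of_lt_of_le one_pos ((le_max_right _ _).trans ht)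
    have h1 := (h t ((le_max_left _ _).trans ht)).le
    have e : f t / t ^ 3 - 1 = (f t - t ^ 3) / t ^ 3 := by field_simp
    rw [Real.dist_eq, e, abs_div, abs_of_pos (pow_pos ht0 3), div_le_iff₀ (pow_pos ht0 3)] at h1
    refine h1.trans ?_
    rw [cubicWeight, abs_of_pos ht0]
    nlinarith
  refine ⟨max R 1, by positivity, fun t ht => ?_⟩
  rcases le_total 0 t with h0 | h0
  · exact key t (by rwa [abs_of_nonneg h0] at ht)
  · have h1 := key (-t) (by rwa [abs_of_nonpos h0] at ht)
    have e : f (-t) - (-t) ^ 3 = -(f t - t ^ 3) := by rw [hf.odd t]; ring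
    rw [e, abs_neg] at h1
    simpa [cubicWeight] using h1

theorem exists_growth (hf : AsymptoticallyCubic f) :
    ∃ A, 0 ≤ A ∧ ∀ t, |f t| ≤ A * cubicWeight t := by
  obtain ⟨δ, hδ, h1⟩ := hf.exists_near one_pos
  obtain ⟨R, hR, h2⟩ := hf.exists_far one_pos
  obtain ⟨M, hM⟩ := (isCompact_Icc (a := -R) (b := R)).exists_bound_of_continuousOn
    hf.continuous.continuousOn
  have hM0 : 0 ≤ M := (norm_nonneg _).trans (hM 0 ⟨by linarith, hR.le⟩)
  have hsub : ∀ t, |f t - t ^ 3| ≤ 1 * cubicWeight t → |f t| ≤ 2 * cubicWeight t := by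
    intro t h
    have e : f t = (f t - t ^ 3) + t ^ 3 := by ring
    have h3 : |t ^ 3| ≤ cubicWeight t := by
      rw [abs_pow, cubicWeight]; linarith [abs_nonneg t]
    rw [e]
    linarith [abs_add_le (f t - t ^ 3) (t ^ 3)]
  refine ⟨2 + M / δ, by positivity, fun t => ?_⟩
  have hw := cubicWeight_nonneg t
  have hMw : 0 ≤ M / δ * cubicWeight t := by positivity
  rcases le_total |t| δ with ht | ht
  · linarith [hsub t (h1 t ht)]
  rcases le_total R |t| with ht' | ht'
  · linarith [hsub t (h2 t ht')]
  have h3 : |f t| ≤ M := hM t (abs_le.mp ht')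
  have h4 : M ≤ M / δ * cubicWeight t := by
    have : δ ≤ cubicWeight t := by
      rw [cubicWeight]; have : 0 ≤ |t| ^ 3 := by positivity
      linarith
    calc M = M / δ * δ := by field_simp
      _ ≤ _ := mul_le_mul_of_nonneg_left this (by positivity)
  linarith

/-- A modulus of continuity of `f` relative to the weight. Increments `b` comparable to `a` are
covered by the growth bound. For small `b / a` the cube is treated by hand, and `f(t) - t³` is small
near `0` and near infinity and uniformly continuous in between. Integrated, this estimate gives the
differentiability of `∫ F(u)` without any passage to subsequences. -/
theorem exists_increment_bound (hf : AsymptoticallyCubic f) {ε : ℝ} (hε : 0 < ε) :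
    ∃ L, 0 ≤ L ∧ ∀ a b, |f (a + b) - f a| ≤ ε * cubicWeight a + L * cubicWeight b := by
  obtain ⟨A, hA, hfA⟩ := hf.exists_growth
  obtain ⟨δ, hδ, h1⟩ := hf.exists_near (ε := ε / 18) (by positivity)
  obtain ⟨R, hR, h2⟩ := hf.exists_far (ε := ε / 18) (by positivity)
  have hgc : Continuous fun t => f t - t ^ 3 := hf.continuous.sub (continuous_pow 3)
  obtain ⟨θ, hθ, h3⟩ := Metric.uniformContinuousOn_iff.mp
    ((isCompact_Icc (a := -(4 * R)) (b := 4 * R)).uniformContinuousOn_of_continuous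
      hgc.continuousOn) (ε / 2 * (δ / 2)) (by positivity)
  -- relative size of the increment below which the oscillation of `f` is relatively small
  set η : ℝ := min (1 / 2) (min (ε / 14) (θ / (4 * R)))
  have hη : 0 < η := by positivity
  have hη1 : η ≤ 1 / 2 := min_le_left _ _
  have hη2 : η ≤ ε / 14 := (min_le_right _ _).trans (min_le_left _ _)
  have hη3 : η ≤ θ / (4 * R) := (min_le_right _ _).trans (min_le_right _ _)
  have hK1 : 1 ≤ 1 + 1 / η := by have := one_div_pos.mpr hη; linarith
  refine ⟨2 * A * (1 + 1 / η) ^ 3, by positivity, fun a b => ?_⟩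
  have hwa := cubicWeight_nonneg a
  have hwb := cubicWeight_nonneg b
  rcases le_total (η * |a|) |b| with hab | hab
  · have ha : |a| ≤ 1 / η * |b| := by
      rw [one_div, ← div_eq_inv_mul, le_div_iff₀ hη]; linarith
    have w1 := cubicWeight_le hK1 (a := a + b) (b := b) (by linarith [abs_add_le a b])
    have w2 := cubicWeight_le hK1 (a := a) (b := b) (by linarith [abs_nonneg b])
    have e1 := (hfA (a + b)).trans (mul_le_mul_of_nonneg_left w1 hA)
    have e2 := (hfA a).trans (mul_le_mul_of_nonneg_left w2 hA)
    have e3 : 0 ≤ ε * cubicWeight a := by positivity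
    refine (abs_sub _ _).trans ?_
    linarith
  have hb2 : |b| ≤ |a| / 2 := by nlinarith [abs_nonneg a]
  have hcube : |(a + b) ^ 3 - a ^ 3| ≤ ε / 2 * cubicWeight a := by
    have e : (a + b) ^ 3 - a ^ 3 = b * (3 * a ^ 2 + 3 * a * b + b ^ 2) := by ring
    have h4 : |3 * a ^ 2 + 3 * a * b + b ^ 2| ≤ 7 * |a| ^ 2 := by
      have q1 : |3 * a ^ 2 + 3 * a * b + b ^ 2| ≤ 3 * |a| ^ 2 + 3 * |a| * |b| + |b| ^ 2 := by
        refine (abs_add_three _ _ _).trans (le_of_eq ?_)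
        simp [abs_mul]
      nlinarith [abs_nonneg a, abs_nonneg b]
    rw [e, abs_mul]
    calc |b| * |3 * a ^ 2 + 3 * a * b + b ^ 2| ≤ (η * |a|) * (7 * |a| ^ 2) :=
          mul_le_mul hab h4 (abs_nonneg _) (by positivity)
      _ = 7 * η * |a| ^ 3 := by ring
      _ ≤ ε / 2 * |a| ^ 3 := mul_le_mul_of_nonneg_right (by linarith) (by positivity)
      _ ≤ _ := mul_le_mul_of_nonneg_left (by rw [cubicWeight]; linarith [abs_nonneg a])
          (by positivity)
  have hw2 : cubicWeight (a + b) ≤ 8 * cubicWeight a := by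
    have := cubicWeight_le (K := 2) (by norm_num) (a := a + b) (b := a)
      (by linarith [abs_add_le a b, abs_nonneg a])
    linarith
  have hcomb : ∀ {x y w : ℝ}, |x| ≤ ε / 18 * (8 * w) → |y| ≤ ε / 18 * w → |x - y| ≤ ε / 2 * w :=
    fun {x y w} hx hy => by linarith [abs_sub x y]
  have hrest : |(f (a + b) - (a + b) ^ 3) - (f a - a ^ 3)| ≤ ε / 2 * cubicWeight a := by
    rcases le_total |a| (δ / 2) with ha | ha
    · exact hcomb ((h1 (a + b) (by linarith [abs_add_le a b])).trans
        (mul_le_mul_of_nonneg_left hw2 (by positivity))) (h1 a (by linarith))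
    rcases le_total (2 * R) |a| with ha' | ha'
    · have hab' : R ≤ |a + b| := by
        have := abs_sub_abs_le_abs_sub a (-b)
        rw [abs_neg, sub_neg_eq_add] at this
        linarith
      exact hcomb ((h2 (a + b) hab').trans
        (mul_le_mul_of_nonneg_left hw2 (by positivity))) (h2 a (by linarith))
    · have hd : dist (a + b) a < θ := by
        rw [Real.dist_eq, add_sub_cancel_left]
        calc |b| ≤ η * |a| := hab
          _ ≤ θ / (4 * R) * (2 * R) := mul_le_mul hη3 ha' (abs_nonneg _) (by positivity)
          _ = θ / 2 := by field_simp; ring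
          _ < θ := by linarith
      have := (h3 (a + b) (abs_le.mp (by linarith [abs_add_le a b])) a
        (abs_le.mp (by linarith)) hd).le
      rw [Real.dist_eq] at this
      refine this.trans (mul_le_mul_of_nonneg_left ?_ (by positivity))
      have : 0 ≤ |a| ^ 3 := by positivity
      rw [cubicWeight]; linarith
  have e : f (a + b) - f a
      = ((f (a + b) - (a + b) ^ 3) - (f a - a ^ 3)) + ((a + b) ^ 3 - a ^ 3) := by ring
  have e3 : 0 ≤ 2 * A * (1 + 1 / η) ^ 3 * cubicWeight b := by positivity
  rw [e]
  linarith [abs_add_le ((f (a + b) - (a + b) ^ 3) - (f a - a ^ 3)) ((a + b) ^ 3 - a ^ 3)]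

theorem hasDerivAt_primitiveF (hf : AsymptoticallyCubic f) (t : ℝ) :
    HasDerivAt (primitiveF f) (f t) t :=
  hf.continuous.integral_hasStrictDerivAt 0 t |>.hasDerivAt

theorem continuous_primitiveF (hf : AsymptoticallyCubic f) : Continuous (primitiveF f) :=
  continuous_iff_continuousAt.mpr fun t => (hf.hasDerivAt_primitiveF t).continuousAt

/-- The same modulus controls the first order Taylor remainder of the primitive `F`. -/
theorem exists_taylor_bound (hf : AsymptoticallyCubic f) {ε : ℝ} (hε : 0 < ε) :
    ∃ L, 0 ≤ L ∧ (∀ a b, |f (a + b) - f a| ≤ ε * cubicWeight a + L * cubicWeight b) ∧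
      ∀ a b, |primitiveF f (a + b) - primitiveF f a - f a * b|
      ≤ (ε * cubicWeight a + L * cubicWeight b) * |b| := by
  obtain ⟨L, hL, h⟩ := hf.exists_increment_bound hε
  refine ⟨L, hL, h, fun a b => ?_⟩
  have hi : ∀ x y, IntervalIntegrable f volume x y :=
    fun x y => hf.continuous.intervalIntegrable x y
  have e : primitiveF f (a + b) - primitiveF f a - f a * b = ∫ t in a..(a + b), (f t - f a) := by
    rw [intervalIntegral.integral_sub (hi _ _) (by simp), intervalIntegral.integral_const,
      primitiveF, primitiveF, intervalIntegral.integral_interval_sub_left (hi _ _) (hi _ _)]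
    simp [mul_comm]
  have hb := intervalIntegral.norm_integral_le_of_norm_le_const (a := a) (b := a + b)
    (f := fun t => f t - f a) (C := ε * cubicWeight a + L * cubicWeight b) (fun t ht => by
      have ht' : |t - a| ≤ 1 * |b| := by
        have := Set.abs_sub_left_of_mem_uIcc (Set.uIoc_subset_uIcc ht)
        simpa using this
      have h1 := h a (t - a)
      rw [add_sub_cancel] at h1
      have h2 := cubicWeight_le le_rfl ht'
      rw [one_pow, one_mul] at h2
      have := mul_le_mul_of_nonneg_left h2 hL
      rw [Real.norm_eq_abs]
      linarith)
  rw [e]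
  simpa using hb

end AsymptoticallyCubic

/-! ### Smoothness of the term `∫ F(u)` -/

/-- A functional with a linear first variation `d` that satisfies quantitative Taylor and increment
estimates is continuously differentiable, with derivative `d`. -/
theorem exists_fderiv_of_estimates {X : Type*} [NormedAddCommGroup X] [NormedSpace ℝ X]
    {N : X → ℝ} {d : X → X → ℝ}
    (d_add : ∀ u v w, d u (v + w) = d u v + d u w) (d_smul : ∀ (c : ℝ) u v, d u (c • v) = c * d u v)
    (d_bound : ∀ u, ∃ C, ∀ v, |d u v| ≤ C * ‖v‖)
    (est : ∀ u, ∀ ε > 0, ∃ L, 0 ≤ L ∧ ∀ h, ‖h‖ ≤ 1 →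
      |N (u + h) - N u - d u h| ≤ (ε + L * ‖h‖) * ‖h‖ ∧
      ∀ v, |d (u + h) v - d u v| ≤ (ε + L * ‖h‖) * ‖v‖) :
    ∃ D : X → X →L[ℝ] ℝ, Continuous D ∧ (∀ u, HasFDerivAt N (D u) u) ∧ ∀ u v, D u v = d u v := by
  choose C hC using d_bound
  let D : X → X →L[ℝ] ℝ := fun u => LinearMap.mkContinuous
    { toFun := d u, map_add' := d_add u, map_smul' := fun c v => d_smul c u v } (C u) (hC u)
  have hD : ∀ u v, D u v = d u v := fun u v => rfl
  have small : ∀ u, ∀ ε > 0, ∃ δ > 0, ∀ h, ‖h‖ < δ → |N (u + h) - N u - D u h| ≤ ε * ‖h‖ ∧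
      ‖D (u + h) - D u‖ ≤ ε := by
    intro u ε hε
    obtain ⟨L, hL, h⟩ := est u (ε / 2) (by positivity)
    refine ⟨min 1 (ε / (2 * (L + 1))), by positivity, fun k hk => ?_⟩
    have hk1 : ‖k‖ ≤ 1 := (hk.trans_le (min_le_left _ _)).le
    have hk2 : ‖k‖ ≤ ε / (2 * (L + 1)) := (hk.trans_le (min_le_right _ _)).le
    have hs : ε / 2 + L * ‖k‖ ≤ ε := by
      rw [le_div_iff₀ (by positivity)] at hk2
      nlinarith [norm_nonneg k]
    refine ⟨((h k hk1).1).trans (mul_le_mul_of_nonneg_right hs (norm_nonneg _)), ?_⟩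
    refine ContinuousLinearMap.opNorm_le_bound _ hε.le fun v => ?_
    exact ((h k hk1).2 v).trans (mul_le_mul_of_nonneg_right hs (norm_nonneg _))
  refine ⟨D, ?_, fun u => ?_, hD⟩
  · rw [Metric.continuous_iff]
    intro u ε hε
    obtain ⟨δ, hδ, h⟩ := small u (ε / 2) (by positivity)
    refine ⟨δ, hδ, fun w hw => ?_⟩
    rw [dist_eq_norm] at hw ⊢
    have := (h (w - u) hw).2
    rw [add_sub_cancel] at this
    linarith
  · rw [hasFDerivAt_iff_isLittleO_nhds_zero, Asymptotics.isLittleO_iff]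
    intro ε hε
    obtain ⟨δ, hδ, h⟩ := small u ε hε
    filter_upwards [Metric.ball_mem_nhds (0 : X) hδ] with k hk
    exact (h k (mem_ball_zero_iff.mp hk)).1

/-- The bound `‖u‖ + C⁴‖u‖³` for the norm of `v ↦ ∫ (|u| + |u|³) |v|` on `H¹_rad(ℝ³)`. -/
noncomputable def weightNorm (u : H1rad) : ℝ := ‖u‖ + sobolevConst ^ 4 * ‖u‖ ^ 3

theorem integrable_cubicWeight (u v : H1rad) :
    Integrable (fun x => cubicWeight (radFn u x) * |radFn v x|) volume ∧
      ∫ x, cubicWeight (radFn u x) * |radFn v x| ≤ weightNorm u * ‖v‖ := by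
  have e : ∀ x, cubicWeight (radFn u x) * |radFn v x| = |radFn u x * radFn v x|
      + |(radFn u x * radFn u x) * (radFn u x * radFn v x)| := by
    intro x
    simp only [cubicWeight, abs_mul]; ring
  have i1 := (integrable_mul_radFn u v).abs
  have i2 := (integrable_mul_four_radFn u u u v).abs
  simp only [e]
  refine ⟨i1.add i2, ?_⟩
  rw [integral_add i1 i2]
  refine (add_le_add (integral_abs_mul_radFn_le u v)
    (integral_abs_mul_four_radFn_le u u u v)).trans_eq ?_
  rw [weightNorm]; ring

theorem weightNorm_le {h : H1rad} (hh : ‖h‖ ≤ 1) :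
    weightNorm h ≤ (1 + sobolevConst ^ 4) * ‖h‖ := by
  have h3 : ‖h‖ ^ 3 ≤ ‖h‖ := pow_le_of_le_one (norm_nonneg _) hh (by norm_num)
  have := mul_le_mul_of_nonneg_left h3 (pow_nonneg sobolevConst_nonneg 4)
  rw [weightNorm]
  linarith

theorem weightNorm_nonneg (u : H1rad) : 0 ≤ weightNorm u := by
  have := sobolevConst_nonneg
  unfold weightNorm; positivity

namespace AsymptoticallyCubic

variable {f : ℝ → ℝ}

theorem integrable_map_mul (hf : AsymptoticallyCubic f) (u v : H1rad) :
    Integrable (fun x => f (radFn u x) * radFn v x) volume := by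
  obtain ⟨A, hA, hfA⟩ := hf.exists_growth
  refine ((integrable_cubicWeight u v).1.const_mul A).mono'
    ((hf.continuous.measurable.comp (measurable_radFn u)).mul
      (measurable_radFn v)).aestronglyMeasurable (.of_forall fun x => ?_)
  rw [Real.norm_eq_abs, abs_mul, ← mul_assoc]
  exact mul_le_mul_of_nonneg_right (hfA _) (abs_nonneg _)

theorem abs_primitiveF_le {A : ℝ} (hA : 0 ≤ A)
    (hfA : ∀ t, |f t| ≤ A * cubicWeight t) (t : ℝ) :
    |primitiveF f t| ≤ A * (cubicWeight t * |t|) := by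
  have hb := intervalIntegral.norm_integral_le_of_norm_le_const (a := 0) (b := t)
    (f := f) (C := A * cubicWeight t) (fun s hs => by
      have hs' : |s| ≤ 1 * |t| := by
        have := Set.abs_sub_left_of_mem_uIcc (Set.uIoc_subset_uIcc hs)
        simpa using this
      have h2 := cubicWeight_le le_rfl hs'
      rw [one_pow, one_mul] at h2
      exact (hfA s).trans (mul_le_mul_of_nonneg_left h2 hA))
  rw [sub_zero, mul_assoc] at hb
  exact hb

theorem integrable_primitiveF (hf : AsymptoticallyCubic f) (u : H1rad) :
    Integrable (fun x => primitiveF f (radFn u x)) volume := by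
  obtain ⟨A, hA, hfA⟩ := hf.exists_growth
  exact ((integrable_cubicWeight u u).1.const_mul A).mono'
    (hf.continuous_primitiveF.measurable.comp (measurable_radFn u)).aestronglyMeasurable
    (.of_forall fun x => abs_primitiveF_le hA hfA _)

theorem integral_map_mul_add (hf : AsymptoticallyCubic f) (u v w : H1rad) :
    ∫ x, f (radFn u x) * radFn (v + w) x
      = (∫ x, f (radFn u x) * radFn v x) + ∫ x, f (radFn u x) * radFn w x := by
  rw [← integral_add (hf.integrable_map_mul u v) (hf.integrable_map_mul u w)]
  refine integral_congr_ae ?_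
  filter_upwards [Lp.coeFn_add (radFn v) (radFn w)] with x hx
  rw [radFn_add, hx, Pi.add_apply, mul_add]

theorem integral_map_mul_smul (f : ℝ → ℝ) (c : ℝ) (u v : H1rad) :
    ∫ x, f (radFn u x) * radFn (c • v) x = c * ∫ x, f (radFn u x) * radFn v x := by
  rw [← integral_const_mul]
  refine integral_congr_ae ?_
  filter_upwards [Lp.coeFn_smul c (radFn v)] with x hx
  rw [radFn_smul, hx, Pi.smul_apply, smul_eq_mul]; ring

theorem abs_integral_map_mul_le (hf : AsymptoticallyCubic f) {A : ℝ} (hA : 0 ≤ A)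
    (hfA : ∀ t, |f t| ≤ A * cubicWeight t) (u v : H1rad) :
    |∫ x, f (radFn u x) * radFn v x| ≤ A * weightNorm u * ‖v‖ :=
  calc |∫ x, f (radFn u x) * radFn v x|
      ≤ ∫ x, A * (cubicWeight (radFn u x) * |radFn v x|) := by
        refine abs_integral_le_integral_abs.trans (integral_mono (hf.integrable_map_mul u v).abs
          ((integrable_cubicWeight u v).1.const_mul A) fun x => ?_)
        rw [abs_mul, ← mul_assoc]
        exact mul_le_mul_of_nonneg_right (hfA _) (abs_nonneg _)
    _ ≤ A * (weightNorm u * ‖v‖) := by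
        rw [integral_const_mul]
        exact mul_le_mul_of_nonneg_left (integrable_cubicWeight u v).2 hA
    _ = _ := by ring

theorem integral_cubicWeight_comb {ε L : ℝ} (u h v : H1rad) :
    Integrable (fun x => (ε * cubicWeight (radFn u x) + L * cubicWeight (radFn h x))
      * |radFn v x|) volume ∧ (0 ≤ ε → 0 ≤ L →
    ∫ x, (ε * cubicWeight (radFn u x) + L * cubicWeight (radFn h x)) * |radFn v x|
      ≤ (ε * weightNorm u + L * weightNorm h) * ‖v‖) := by
  have e : ∀ x, (ε * cubicWeight (radFn u x) + L * cubicWeight (radFn h x)) * |radFn v x|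
      = ε * (cubicWeight (radFn u x) * |radFn v x|)
        + L * (cubicWeight (radFn h x) * |radFn v x|) := fun x => by ring
  have i1 := (integrable_cubicWeight u v).1.const_mul ε
  have i2 := (integrable_cubicWeight h v).1.const_mul L
  simp only [e]
  refine ⟨i1.add i2, fun hε hL => ?_⟩
  rw [integral_add i1 i2, integral_const_mul, integral_const_mul]
  have b1 := mul_le_mul_of_nonneg_left (integrable_cubicWeight u v).2 hε
  have b2 := mul_le_mul_of_nonneg_left (integrable_cubicWeight h v).2 hL
  linarith

theorem potential_taylor_bound (hf : AsymptoticallyCubic f) {ε L : ℝ} (hε : 0 ≤ ε) (hL : 0 ≤ L)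
    (htay : ∀ a b, |primitiveF f (a + b) - primitiveF f a - f a * b|
      ≤ (ε * cubicWeight a + L * cubicWeight b) * |b|) (u h : H1rad) :
    |(∫ x, primitiveF f (radFn (u + h) x)) - (∫ x, primitiveF f (radFn u x))
      - ∫ x, f (radFn u x) * radFn h x| ≤ (ε * weightNorm u + L * weightNorm h) * ‖h‖ := by
  have i : Integrable (fun x => primitiveF f (radFn (u + h) x) - primitiveF f (radFn u x)) volume :=
    (hf.integrable_primitiveF (u + h)).sub (hf.integrable_primitiveF u)
  rw [← integral_sub (hf.integrable_primitiveF _) (hf.integrable_primitiveF _),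
    ← integral_sub i (hf.integrable_map_mul u h)]
  have hmaj := integral_cubicWeight_comb (ε := ε) (L := L) u h h
  refine abs_integral_le_integral_abs.trans ((integral_mono_ae
    (i.sub (hf.integrable_map_mul u h)).abs hmaj.1 ?_).trans (hmaj.2 hε hL))
  filter_upwards [Lp.coeFn_add (radFn u) (radFn h)] with x hx
  simp only [Pi.sub_apply, radFn_add, hx]
  exact htay _ _

theorem potential_increment_bound (hf : AsymptoticallyCubic f) {ε L : ℝ} (hε : 0 ≤ ε) (hL : 0 ≤ L)
    (hinc : ∀ a b, |f (a + b) - f a| ≤ ε * cubicWeight a + L * cubicWeight b) (u h v : H1rad) :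
    |(∫ x, f (radFn (u + h) x) * radFn v x) - ∫ x, f (radFn u x) * radFn v x|
      ≤ (ε * weightNorm u + L * weightNorm h) * ‖v‖ := by
  rw [← integral_sub (hf.integrable_map_mul _ v) (hf.integrable_map_mul u v)]
  have hmaj := integral_cubicWeight_comb (ε := ε) (L := L) u h v
  refine abs_integral_le_integral_abs.trans ((integral_mono_ae
    ((hf.integrable_map_mul _ v).sub (hf.integrable_map_mul u v)).abs hmaj.1 ?_).trans
      (hmaj.2 hε hL))
  filter_upwards [Lp.coeFn_add (radFn u) (radFn h)] with x hx
  simp only [Pi.sub_apply, radFn_add, hx, Pi.add_apply, ← sub_mul, abs_mul]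
  exact mul_le_mul_of_nonneg_right (hinc _ _) (abs_nonneg _)

theorem potential_estimates (hf : AsymptoticallyCubic f) (u : H1rad) {ε : ℝ} (hε : 0 < ε) :
    ∃ L, 0 ≤ L ∧ ∀ h : H1rad, ‖h‖ ≤ 1 →
      |(∫ x, primitiveF f (radFn (u + h) x)) - (∫ x, primitiveF f (radFn u x))
        - ∫ x, f (radFn u x) * radFn h x| ≤ (ε + L * ‖h‖) * ‖h‖ ∧
      ∀ v : H1rad, |(∫ x, f (radFn (u + h) x) * radFn v x) - ∫ x, f (radFn u x) * radFn v x|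
        ≤ (ε + L * ‖h‖) * ‖v‖ := by
  have hW := weightNorm_nonneg u
  have hS := sobolevConst_nonneg
  have hε0 : 0 < ε / (weightNorm u + 1) := by positivity
  have hεW : ε / (weightNorm u + 1) * weightNorm u ≤ ε := by
    rw [div_mul_eq_mul_div, div_le_iff₀ (by positivity)]
    nlinarith
  obtain ⟨L, hL, hinc, htay⟩ := hf.exists_taylor_bound hε0
  refine ⟨L * (1 + sobolevConst ^ 4), by positivity, fun h hh => ?_⟩
  have hle : ε / (weightNorm u + 1) * weightNorm u + L * weightNorm h
      ≤ ε + L * (1 + sobolevConst ^ 4) * ‖h‖ := by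
    rw [mul_assoc L]
    exact add_le_add hεW (mul_le_mul_of_nonneg_left (weightNorm_le hh) hL)
  exact ⟨(hf.potential_taylor_bound hε0.le hL htay u h).trans
    (mul_le_mul_of_nonneg_right hle (norm_nonneg _)), fun v =>
    (hf.potential_increment_bound hε0.le hL hinc u h v).trans
    (mul_le_mul_of_nonneg_right hle (norm_nonneg _))⟩

theorem exists_fderiv_potential (hf : AsymptoticallyCubic f) :
    ∃ D : H1rad → H1rad →L[ℝ] ℝ, Continuous D ∧
      (∀ u, HasFDerivAt (fun u => ∫ x, primitiveF f (radFn u x)) (D u) u) ∧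
      ∀ u v, D u v = ∫ x, f (radFn u x) * radFn v x := by
  obtain ⟨A, hA, hfA⟩ := hf.exists_growth
  exact exists_fderiv_of_estimates hf.integral_map_mul_add (integral_map_mul_smul f)
    (fun u => ⟨A * weightNorm u, hf.abs_integral_map_mul_le hA hfA u⟩)
    fun u ε hε => hf.potential_estimates u hε

end AsymptoticallyCubic

/-! ### The derivative of the energy -/

theorem exists_fderiv_half_normSq_add {X : Type*} [NormedAddCommGroup X] [InnerProductSpace ℝ X]
    {E Q H P : X → ℝ} {c : ℝ} {DH DP : X → X →L[ℝ] ℝ} (hQ : ∀ u, Q u = ‖u‖ ^ 2)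
    (hE : ∀ u, E u = 1 / 2 * Q u + c * H u - P u)
    (cH : Continuous DH) (cP : Continuous DP) (hH : ∀ u, HasFDerivAt H (DH u) u)
    (hP : ∀ u, HasFDerivAt P (DP u) u) :
    ∃ D : X → X →L[ℝ] ℝ, Continuous D ∧ (∀ u, HasFDerivAt E (D u) u) ∧
      ∀ u v, D u v = inner ℝ u v + c * DH u v - DP u v := by
  refine ⟨fun u => innerSL ℝ u + c • DH u - DP u,
    ((innerSL ℝ).continuous.add (cH.const_smul c)).sub cP, fun u => ?_, fun u v => by simp⟩
  have h1 : HasFDerivAt (fun u : X => 1 / 2 * ‖u‖ ^ 2) (innerSL ℝ u) u := by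
    refine ((hasStrictFDerivAt_norm_sq u).hasFDerivAt.const_mul (1 / 2 : ℝ)).congr_fderiv ?_
    ext v; simp
  have e : E = fun u => 1 / 2 * ‖u‖ ^ 2 + c * H u - P u := by
    ext u; rw [hE, hQ]
  rw [e]
  exact (h1.add ((hH u).const_mul c)).sub (hP u)

theorem integral_grad_sq_add_sq (u : H1rad) :
    ∫ x, (‖radGrad u x‖ ^ 2 + radFn u x ^ 2) = ‖u‖ ^ 2 := by
  have e1 : ‖radGrad u‖ ^ 2 = ∫ x, ‖radGrad u x‖ ^ 2 := by
    rw [← real_inner_self_eq_norm_sq, L2.inner_def]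
    simp only [real_inner_self_eq_norm_sq]
  have e2 : ‖radFn u‖ ^ 2 = ∫ x, radFn u x ^ 2 := by
    rw [← real_inner_self_eq_norm_sq, L2.inner_def]
    simp only [real_inner_self_eq_norm_sq, Real.norm_eq_abs, sq_abs]
  rw [norm_sq_eq_radFn_radGrad, e1, e2, integral_add, add_comm]
  · exact (memLp_two_iff_integrable_sq_norm (Lp.aestronglyMeasurable _)).mp (Lp.memLp _)
  · exact (Lp.memLp _).integrable_sq

set_option maxHeartbeats 1000000 in
theorem exists_fderiv_energy {f : ℝ → ℝ} (hf : AsymptoticallyCubic f) (lam : ℝ) :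
    ∃ D : H1rad → H1rad →L[ℝ] ℝ, Continuous D ∧ (∀ u, fderiv ℝ (energy f lam) u = D u) ∧
      ∀ u v, D u v = inner ℝ u v + lam / 4 * (2 * hartreeForm u v u u + 2 * hartreeForm u u u v)
        - ∫ x, f (radFn u x) * radFn v x := by
  obtain ⟨DH, cH, hH, aH⟩ := exists_fderiv_hartree
  obtain ⟨DP, cP, hP, aP⟩ := hf.exists_fderiv_potential
  obtain ⟨D, cD, hD, aD⟩ := exists_fderiv_half_normSq_add (E := energy f lam)
    integral_grad_sq_add_sq (fun u => rfl) cH cP hH hP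
  exact ⟨D, cD, fun u => (hD u).fderiv, fun u v => (aD u v).trans
    (congrArg₂ (fun a b => inner ℝ u v + lam / 4 * a - b) (aH u v) (aP u v))⟩

/-- A bounded functional on `H¹_rad(ℝ³)` is an `L²` pairing with the function and the gradient:
Hahn–Banach and the Riesz theorem in the ambient Hilbert space, so completeness of `H1rad` is not
needed. -/
theorem exists_riesz_H1rad (ℓ : H1rad →L[ℝ] ℝ) :
    ∃ (a : Lp ℝ 2 (volume : Measure R3)) (p : Lp R3 2 (volume : Measure R3)),
      ∀ v, ℓ v = inner ℝ a (radFn v) + inner ℝ p (radGrad v) := by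
  obtain ⟨g, hg, -⟩ := exists_extension_norm_eq H1rad ℓ
  let z := (InnerProductSpace.toDual ℝ _).symm g
  refine ⟨z.fst, z.snd, fun v => ?_⟩
  rw [← hg v]
  exact (InnerProductSpace.toDual_symm_apply (y := g)).symm.trans (WithLp.prod_inner_apply _ _)

/-- A bounded sequence of `H¹_rad(ℝ³)` that converges in `L²` converges weakly in `H¹`. -/
theorem tendsto_inner_of_tendsto_radFn (a : Lp ℝ 2 (volume : Measure R3))
    (p : Lp R3 2 (volume : Measure R3)) {v : ℕ → H1rad} {v' : H1rad} {M : ℝ}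
    (hM : ∀ n, ‖v n‖ ≤ M) (h : Tendsto (fun n => radFn (v n)) atTop (𝓝 (radFn v'))) :
    Tendsto (fun n => inner ℝ a (radFn (v n)) + inner ℝ p (radGrad (v n)))
      (hyperfilter ℕ : Filter ℕ) (𝓝 (inner ℝ a (radFn v') + inner ℝ p (radGrad v'))) := by
  have h' := h.mono_left Nat.hyperfilter_le_atTop
  obtain ⟨q, hq⟩ := exists_weak_limit (fun n => (norm_radGrad_le (v n)).trans (hM n))
    (hyperfilter ℕ)
  have hqw : IsWeakGradient (radFn v') q :=
    IsWeakGradient.of_tendsto (fun n => isWeakGradient_radGrad (v n)) h' hq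
  rw [hqw.unique (isWeakGradient_radGrad v')] at hq
  have h2 := hq p
  simp only [real_inner_comm p] at h2
  exact (tendsto_const_nhds.inner h').add h2

theorem integral_pow_four_le {w z : H1rad} (h : ∀ᵐ x, |radFn w x| ≤ |radFn z x|) :
    ∫ x, radFn w x ^ 4 ≤ sobolevConst ^ 4 * ‖z‖ ^ 4 := by
  have e : ∀ (u : H1rad) x, (radFn u x * radFn u x) * (radFn u x * radFn u x) = radFn u x ^ 4 :=
    fun u x => by ring
  have iw := integrable_mul_four_radFn w w w w
  have iz := integrable_mul_four_radFn z z z z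
  have hz := integral_abs_mul_four_radFn_le z z z z
  simp only [e] at iw iz hz
  calc ∫ x, radFn w x ^ 4 ≤ ∫ x, |radFn z x ^ 4| := by
        refine integral_mono_ae iw iz.abs ?_
        filter_upwards [h] with x hx
        rw [abs_pow, ← Even.pow_abs (by decide : Even 4)]
        exact pow_le_pow_left₀ (abs_nonneg _) hx 4
    _ ≤ sobolevConst ^ 4 * (‖z‖ * ‖z‖ * (‖z‖ * ‖z‖)) := hz
    _ = _ := by ring

theorem integrable_pow_four (w : H1rad) : Integrable (fun x => radFn w x ^ 4) volume :=
  (integrable_mul_four_radFn w w w w).congr (.of_forall fun x => by ring)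

/-- The lower bound on the Nehari set, for `w = u⁺` or `w = u⁻`. As the Hartree term is nonnegative
and `f(t) t ≤ t⁴`, the equation `I'(u)[w] = 0` gives `‖w‖² ≤ |w|₄⁴`. With `|w|₄ ≤ C ‖w‖` this bounds
`‖w‖`, hence `|w|₄`, away from zero. -/
theorem one_le_integral_pow_four {f : ℝ → ℝ} (hf : AsymptoticallyCubic f) {lam : ℝ} (hlam : 0 ≤ lam)
    {u w : H1rad} (hw : radFn w ≠ 0) (hin : ‖w‖ ^ 2 ≤ inner ℝ u w)
    (hpos : ∀ᵐ x, 0 ≤ radFn u x * radFn w x)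
    (hfw : ∀ᵐ x, f (radFn u x) * radFn w x ≤ radFn w x ^ 4)
    (h0 : inner ℝ u w + lam / 4 * (2 * hartreeForm u w u u + 2 * hartreeForm u u u w)
        - ∫ x, f (radFn u x) * radFn w x = 0) :
    1 ≤ sobolevConst ^ 4 * ∫ x, radFn w x ^ 4 := by
  have hS := sobolevConst_nonneg
  have huu : ∀ᵐ x, 0 ≤ radFn u x * radFn u x := .of_forall fun x => mul_self_nonneg _
  have hH : 0 ≤ lam / 4 * (2 * hartreeForm u w u u + 2 * hartreeForm u u u w) := by
    have := hartreeForm_nonneg hpos huu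
    have := hartreeForm_nonneg huu hpos
    positivity
  have hle : ∫ x, f (radFn u x) * radFn w x ≤ ∫ x, radFn w x ^ 4 :=
    integral_mono_ae (hf.integrable_map_mul u w) (integrable_pow_four w) hfw
  have h1 : ‖w‖ ^ 2 ≤ ∫ x, radFn w x ^ 4 := by linarith
  have h2 : ∫ x, radFn w x ^ 4 ≤ sobolevConst ^ 4 * ‖w‖ ^ 4 :=
    integral_pow_four_le (.of_forall fun x => le_rfl)
  have hw0 : 0 < ‖w‖ ^ 2 := by
    have h4 : 0 < ‖radFn w‖ := norm_pos_iff.mpr hw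
    exact pow_pos (h4.trans_le (norm_radFn_le w)) 2
  have h3 : 1 ≤ sobolevConst ^ 4 * ‖w‖ ^ 2 := by
    have : ‖w‖ ^ 2 * 1 ≤ ‖w‖ ^ 2 * (sobolevConst ^ 4 * ‖w‖ ^ 2) := by nlinarith
    exact le_of_mul_le_mul_left this hw0
  exact h3.trans (mul_le_mul_of_nonneg_left h1 (by positivity))

theorem coeFn_sub_sup_zero (u : Lp ℝ 2 (volume : Measure R3)) :
    ∀ᵐ x ∂(volume : Measure R3), (u - u ⊔ 0 : Lp ℝ 2 (volume : Measure R3)) x = u x ⊓ 0 := by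
  filter_upwards [coeFn_sup_zero u, Lp.coeFn_sub u (u ⊔ 0)] with x h1 h2
  rw [h2, Pi.sub_apply, h1, sub_eq_iff_eq_add, inf_add_sup, add_zero]

theorem sub_sup_zero_eq (u : Lp ℝ 2 (volume : Measure R3)) : u - u ⊔ 0 = u ⊓ 0 := by
  rw [sub_eq_iff_eq_add, inf_add_sup, add_zero]

/-! ### Closedness of the nodal Nehari set -/

theorem one_le_integral_posPart_pow_four {f : ℝ → ℝ} (hf : AsymptoticallyCubic f) {lam : ℝ}
    (hlam : 0 ≤ lam) {u v : H1rad} (hv : radFn v = radFn u ⊔ 0) (hv0 : radFn u ⊔ 0 ≠ 0)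
    (h0 : inner ℝ u v + lam / 4 * (2 * hartreeForm u v u u + 2 * hartreeForm u u u v)
        - ∫ x, f (radFn u x) * radFn v x = 0) :
    1 ≤ sobolevConst ^ 4 * ∫ x, radFn v x ^ 4 := by
  have hx : ∀ᵐ x, radFn v x = radFn u x ⊔ 0 := hv ▸ coeFn_sup_zero (radFn u)
  refine one_le_integral_pow_four hf hlam (hv ▸ hv0) (H1rad.norm_posPart_sq_le hv) ?_ ?_ h0
  · filter_upwards [hx] with x hx
    rw [hx]
    rcases le_total 0 (radFn u x) with h | h
    · rw [sup_eq_left.mpr h]; exact mul_self_nonneg _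
    · rw [sup_eq_right.mpr h, mul_zero]
  · filter_upwards [hx] with x hx
    rw [hx]
    rcases le_total 0 (radFn u x) with h | h
    · rw [sup_eq_left.mpr h]; exact hf.mul_self_le _
    · rw [sup_eq_right.mpr h]; simp

theorem one_le_integral_negPart_pow_four {f : ℝ → ℝ} (hf : AsymptoticallyCubic f) {lam : ℝ}
    (hlam : 0 ≤ lam) {u v : H1rad} (hv : radFn v = radFn u ⊔ 0) (hv0 : radFn u ⊓ 0 ≠ 0)
    (h0 : inner ℝ u (u - v) + lam / 4 * (2 * hartreeForm u (u - v) u u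
      + 2 * hartreeForm u u u (u - v)) - ∫ x, f (radFn u x) * radFn (u - v) x = 0) :
    1 ≤ sobolevConst ^ 4 * ∫ x, radFn (u - v) x ^ 4 := by
  have hw : radFn (u - v) = radFn u - radFn u ⊔ 0 := by rw [radFn_sub, hv]
  have hx : ∀ᵐ x, radFn (u - v) x = radFn u x ⊓ 0 := hw ▸ coeFn_sub_sup_zero (radFn u)
  refine one_le_integral_pow_four hf hlam (by rwa [hw, sub_sup_zero_eq])
    (H1rad.norm_negPart_sq_le hv) ?_ ?_ h0
  · filter_upwards [hx] with x hx
    rw [hx]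
    rcases le_total (radFn u x) 0 with h | h
    · rw [inf_eq_left.mpr h]; exact mul_self_nonneg _
    · rw [inf_eq_right.mpr h, mul_zero]
  · filter_upwards [hx] with x hx
    rw [hx]
    rcases le_total (radFn u x) 0 with h | h
    · rw [inf_eq_left.mpr h]; exact hf.mul_self_le _
    · rw [inf_eq_right.mpr h]; simp

/-- If the limit `u'` were nonpositive, then `0 ≤ uₙ⁺ ≤ |uₙ - u'|` would force `|uₙ⁺|₄ → 0`. -/
theorem posPart_ne_zero_of_tendsto {u v : ℕ → H1rad} {u' : H1rad} (hu : Tendsto u atTop (𝓝 u'))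
    (hv : ∀ n, radFn (v n) = radFn (u n) ⊔ 0)
    (h1 : ∀ n, 1 ≤ sobolevConst ^ 4 * ∫ x, radFn (v n) x ^ 4) : radFn u' ⊔ 0 ≠ 0 := by
  intro h0
  have hle : ∀ n, 1 ≤ sobolevConst ^ 4 * (sobolevConst ^ 4 * ‖u n - u'‖ ^ 4) := fun n => by
    refine (h1 n).trans (mul_le_mul_of_nonneg_left (integral_pow_four_le ?_)
      (pow_nonneg sobolevConst_nonneg 4))
    filter_upwards [coeFn_sup_zero (radFn u'), Lp.coeFn_sub (radFn (u n)) (radFn u'),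
      coeFn_sup_zero (radFn (u n)), Lp.coeFn_zero ℝ 2 (volume : Measure R3)] with x a1 a2 a3 a4
    rw [h0, a4, Pi.zero_apply] at a1
    have hx : radFn u' x ≤ 0 := a1 ▸ le_sup_left
    rw [hv, a3, radFn_sub, a2, Pi.sub_apply, abs_of_nonneg le_sup_right]
    exact sup_le (by linarith [le_abs_self (radFn (u n) x - radFn u' x)]) (abs_nonneg _)
  have hlim : Tendsto (fun n => sobolevConst ^ 4 * (sobolevConst ^ 4 * ‖u n - u'‖ ^ 4)) atTop
      (𝓝 (sobolevConst ^ 4 * (sobolevConst ^ 4 * 0 ^ 4))) :=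
    (((tendsto_iff_norm_sub_tendsto_zero.mp hu).pow 4).const_mul _).const_mul _
  have := ge_of_tendsto' hlim hle
  norm_num at this

theorem negPart_ne_zero_of_tendsto {u v : ℕ → H1rad} {u' : H1rad} (hu : Tendsto u atTop (𝓝 u'))
    (hv : ∀ n, radFn (v n) = radFn (u n) ⊔ 0)
    (h1 : ∀ n, 1 ≤ sobolevConst ^ 4 * ∫ x, radFn (u n - v n) x ^ 4) : radFn u' ⊓ 0 ≠ 0 := by
  intro h0
  have hle : ∀ n, 1 ≤ sobolevConst ^ 4 * (sobolevConst ^ 4 * ‖u n - u'‖ ^ 4) := fun n => by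
    refine (h1 n).trans (mul_le_mul_of_nonneg_left (integral_pow_four_le ?_)
      (pow_nonneg sobolevConst_nonneg 4))
    filter_upwards [coeFn_sub_sup_zero (radFn u'), Lp.coeFn_sub (radFn (u n)) (radFn u'),
      coeFn_sub_sup_zero (radFn (u n)), Lp.coeFn_zero ℝ 2 (volume : Measure R3)] with x a1 a2 a3 a4
    rw [sub_sup_zero_eq, h0, a4, Pi.zero_apply] at a1
    have hx : 0 ≤ radFn u' x := a1 ▸ inf_le_left
    rw [radFn_sub (u n) (v n), hv, a3, radFn_sub, a2, Pi.sub_apply, abs_of_nonpos inf_le_right,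
      neg_le]
    exact le_inf (by linarith [neg_abs_le (radFn (u n) x - radFn u' x)])
      (neg_nonpos.mpr (abs_nonneg _))
  have hlim : Tendsto (fun n => sobolevConst ^ 4 * (sobolevConst ^ 4 * ‖u n - u'‖ ^ 4)) atTop
      (𝓝 (sobolevConst ^ 4 * (sobolevConst ^ 4 * 0 ^ 4))) :=
    (((tendsto_iff_norm_sub_tendsto_zero.mp hu).pow 4).const_mul _).const_mul _
  have := ge_of_tendsto' hlim hle
  norm_num at this

theorem tendsto_radFn {u : ℕ → H1rad} {u' : H1rad} (hu : Tendsto u atTop (𝓝 u')) :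
    Tendsto (fun n => radFn (u n)) atTop (𝓝 (radFn u')) := by
  refine tendsto_iff_norm_sub_tendsto_zero.mpr (squeeze_zero (fun _ => norm_nonneg _)
    (fun n => norm_radFn_le (u n - u')) (tendsto_iff_norm_sub_tendsto_zero.mp hu))

theorem tendsto_clm_apply_zero_of_bounded {X : Type*} [NormedAddCommGroup X] [NormedSpace ℝ X]
    {D : X → X →L[ℝ] ℝ} (hD : Continuous D) {u v : ℕ → X} {u' : X}
    (hu : Tendsto u atTop (𝓝 u')) {M : ℝ} (hM : ∀ n, ‖v n‖ ≤ M) (h0 : ∀ n, D (u n) (v n) = 0) :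
    Tendsto (fun n => D u' (v n)) atTop (𝓝 0) := by
  have h1 : Tendsto (fun n => ‖D (u n) - D u'‖ * M) atTop (𝓝 (0 * M)) :=
    (tendsto_iff_norm_sub_tendsto_zero.mp ((hD.tendsto u').comp hu)).mul_const M
  rw [zero_mul] at h1
  refine squeeze_zero_norm (fun n => ?_) h1
  have e : D u' (v n) = -((D (u n) - D u') (v n)) := by
    rw [sub_apply, h0, zero_sub, neg_neg]
  rw [e, norm_neg]
  exact (ContinuousLinearMap.le_opNorm _ _).trans
    (mul_le_mul_of_nonneg_left (hM n) (norm_nonneg _))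

theorem clm_apply_self_eq_zero_of_tendsto {X : Type*} [NormedAddCommGroup X] [NormedSpace ℝ X]
    {D : X → X →L[ℝ] ℝ} (hD : Continuous D) {u : ℕ → X} {u' : X}
    (hu : Tendsto u atTop (𝓝 u')) (h0 : ∀ n, D (u n) (u n) = 0) : D u' u' = 0 := by
  have h1 : Tendsto (fun n => D (u n) (u n)) atTop (𝓝 (D u' u')) :=
    ((hD.clm_apply continuous_id).tendsto u').comp hu
  exact tendsto_nhds_unique h1 (by simp only [h0]; exact tendsto_const_nhds)

/-- The positive parts are bounded in `H¹` and converge in `L²`, hence weakly in `H¹`, while the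
derivatives converge in norm. So the equation for the positive parts passes to the limit. -/
theorem map_posPart_eq_zero_of_tendsto {D : H1rad → H1rad →L[ℝ] ℝ} (hD : Continuous D)
    {u v : ℕ → H1rad} {u' v' : H1rad} (hu : Tendsto u atTop (𝓝 u'))
    (hv : ∀ n, radFn (v n) = radFn (u n) ⊔ 0) (hv' : radFn v' = radFn u' ⊔ 0)
    (h0 : ∀ n, D (u n) (v n) = 0) : D u' v' = 0 := by
  obtain ⟨M, hM⟩ := hu.norm.bddAbove_range
  have hvM : ∀ n, ‖v n‖ ≤ M := fun n => (H1rad.norm_posPart_le (hv n)).trans (hM ⟨n, rfl⟩)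
  have hvlim : Tendsto (fun n => radFn (v n)) atTop (𝓝 (radFn v')) := by
    simp only [hv, hv']
    exact (tendsto_radFn hu).sup_nhds tendsto_const_nhds
  obtain ⟨a, p, hap⟩ := exists_riesz_H1rad (D u')
  have h1 := (tendsto_clm_apply_zero_of_bounded hD hu hvM h0).mono_left Nat.hyperfilter_le_atTop
  have h2 := tendsto_inner_of_tendsto_radFn a p hvM hvlim
  exact (hap v').trans (tendsto_nhds_unique (h2.congr fun n => (hap (v n)).symm) h1)

theorem proposition3p2 (f : ℝ → ℝ) (hf : AsymptoticallyCubic f) (lam : ℝ) (hlam : 0 < lam) :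
    IsClosed (nodalNehariSet f lam) := by
  obtain ⟨D, hDc, hDf, hDa⟩ := exists_fderiv_energy hf lam
  refine IsSeqClosed.isClosed fun u u' hu hlim => ?_
  choose hN hpos hp hm using hu
  choose v hv hDv using hpos
  have hDv' : ∀ n, D (u n) (v n) = 0 := fun n => by rw [← hDf]; exact hDv n
  have hDu' : ∀ n, D (u n) (u n) = 0 := fun n => by rw [← hDf]; exact (hN n).2
  have hDw' : ∀ n, D (u n) (u n - v n) = 0 := fun n => by
    rw [map_sub, hDv', hDu', sub_zero]
  have hp' : radFn u' ⊔ 0 ≠ 0 := posPart_ne_zero_of_tendsto hlim hv fun n =>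
    one_le_integral_posPart_pow_four hf hlam.le (hv n) (hp n) ((hDa _ _).symm.trans (hDv' n))
  have hm' : radFn u' ⊓ 0 ≠ 0 := negPart_ne_zero_of_tendsto hlim hv fun n =>
    one_le_integral_negPart_pow_four hf hlam.le (hv n) (hm n) ((hDa _ _).symm.trans (hDw' n))
  obtain ⟨v', hv'⟩ := H1rad.exists_posPart u'
  refine ⟨⟨?_, ?_⟩, ⟨v', hv', ?_⟩, hp', hm'⟩
  · rintro rfl
    exact hp' (sup_idem 0)
  · rw [hDf]; exact clm_apply_self_eq_zero_of_tendsto hDc hlim hDu'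
  · rw [hDf]; exact map_posPart_eq_zero_of_tendsto hDc hlim hv hv' hDv'
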